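/- Let $(\mathcal C;\mathcal E)$ and $(\mathcal D;\mathcal E')$ be weakly idempotent complete exact categories (in the sense of Quillen), and let $\mathrm q:\mathcal C\rightleftarrows\mathcal D:\mathrm t$ be an adjoint pair of functors, $\mathrm q$ left adjoint to $\mathrm t$, with unit $\eta:\mathrm{id}_{\mathcal C}\Rightarrow \mathrm{tq}$ and counit $\xi:\mathrm{qt}\Rightarrow\mathrm{id}_{\mathcal D}$. For $n\ge 1$ let $\operatorname{Ext}^n(X,A)$ denote the Yoneda extension group of equivalence classes of exact sequences $A\rightarrowtail B_n\to\cdots\to B_1\twoheadrightarrow X$. If $X\in\mathcal C$ and $\mathrm t$ preserves the exact sequences in $\operatorname{Ext}^n(\mathrm q(X),-)$, let $$\Theta^n_X:\operatorname{Ext}^n(\mathrm q(X),-)\Longrightarrow\operatorname{Ext}^n(X,\mathrm t(-))$$ be the natural transformation that sends the class of $\mathbb E$ to the class of the pullback of $\mathrm t(\mathbb E)$ along $\eta_X$. Dually, if $A\in\mathcal D$ and $\mathrm q$ preserves the exact sequences in $\operatorname{Ext}^n(-,\mathrm t(A))$, let $$\Omega^n_A:\operatorname{Ext}^n(-,\mathrm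 t(A))\Longrightarrow\operatorname{Ext}^n(\mathrm q(-),A)$$ be the natural transformation that sends the class of $\mathbb E$ to the class of the pushout of $\mathrm q(\mathbb E)$ along $\xi_A$. Let $\mathcal F$ be an extension-closed class of objects of $\mathcal C$ that is generating (every object $X$ of $\mathcal C$ admits an admissible epic $F\twoheadrightarrow X$ with $F\in\mathcal F$) and closed under kernels of admissible epics between objects of $\mathcal F$. Let $\mathcal G$ be an extension-closed class of objects of $\mathcal D$ that is cogenerating (every object $A$ of $\mathcal D$ admits an admissible monic $A\rightarrowtail G$ with $G\in\mathcal G$) and closed under cokernels of admissible monics between objects of $\mathcal G$. The following hold. (i) Suppose that $\mathrm t$ preserves the short exact sequences in $\operatorname{Ext}^1(\mathrm q(F),-)$ for every $F\in\mathcal F$. Then $\mathrm t$ preserves the exact sequences in $\operatorname{Ext}^n(\mathrm q(F),-)$ for every $F\in\mathcal F$ and $n\ge1$, so that $\Theta^n_F$ is defined, and the restriction of $\mathrm q$ to $\mathcal F$ is exact (that is, $\mathrm q$ preserves the short exact sequences of $\mathcal C$ with all terms in $\mathcal F$) if and only if $\Theta^n_F$ is an isomorphism for every $F\in\mathcal F$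 and every $n\ge 1$. (ii) Suppose that $\mathrm q$ preserves the short exact sequences in $\operatorname{Ext}^1(-,\mathrm t(G))$ for every $G\in\mathcal G$. Then $\mathrm q$ preserves the exact sequences in $\operatorname{Ext}^n(-,\mathrm t(G))$ for every $G\in\mathcal G$ and $n\ge1$, so that $\Omega^n_G$ is defined, and the restriction of $\mathrm t$ to $\mathcal G$ is exact (that is, $\mathrm t$ preserves the short exact sequences of $\mathcal D$ with all terms in $\mathcal G$) if and only if $\Omega^n_G$ is an isomorphism for every $G\in\mathcal G$ and every $n\ge 1$. -/

import Mathlib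

open CategoryTheory CategoryTheory.Limits

universe v u v₁ u₁ v₂ u₂

/-- An additive category is weakly idempotent complete if every retraction has a kernel
(equivalently, every coretraction has a cokernel). -/
def WeaklyIdempotentComplete (𝒞 : Type u) [Category.{v} 𝒞] [Preadditive 𝒞] : Prop :=
  ∀ ⦃X Y : 𝒞⦄ (r : X ⟶ Y), IsSplitEpi r → HasKernel r

/-- A class of sequences `A ⟶ B ⟶ X` in a category. -/
abbrev SeqClass (𝒞 : Type u) [Category.{v} 𝒞] : Type (max u v) :=
  ∀ ⦃A B X : 𝒞⦄, (A ⟶ B) → (B ⟶ X) → Prop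

/-- The first morphisms of the sequences of the class. -/
def SeqClass.AdmissibleMonic {𝒞 : Type u} [Category.{v} 𝒞] (P : SeqClass 𝒞)
    {A B : 𝒞} (i : A ⟶ B) : Prop :=
  ∃ (X : 𝒞) (p : B ⟶ X), P i p

/-- The second morphisms of the sequences of the class. -/
def SeqClass.AdmissibleEpic {𝒞 : Type u} [Category.{v} 𝒞] (P : SeqClass 𝒞)
    {B X : 𝒞} (p : B ⟶ X) : Prop :=
  ∃ (A : 𝒞) (i : A ⟶ B), P i p

/-- An exact structure (in the sense of Quillen) on an additive category: an isomorphism-closed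
class of kernel-cokernel pairs `A ⟶ B ⟶ X`, called short exact sequences, such that identities are
admissible monics and admissible epics, admissible monics and admissible epics are closed under
composition, and the class is closed under pushouts along morphisms out of `A` and under pullbacks
along morphisms into `X`. -/
structure ExactStructure (𝒞 : Type u) [Category.{v} 𝒞] [Preadditive 𝒞] where
  /-- the short exact sequences -/
  Ses : SeqClass 𝒞
  kernel_cokernel : ∀ {A B X : 𝒞} {i : A ⟶ B} {p : B ⟶ X}, Ses i p →
    ∃ w : i ≫ p = 0, Nonempty (IsLimit (KernelFork.ofι i w)) ∧
      Nonempty (IsColimit (CokernelCofork.ofπ p w))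
  of_iso : ∀ {A B X A' B' X' : 𝒞} {i : A ⟶ B} {p : B ⟶ X} {i' : A' ⟶ B'} {p' : B' ⟶ X'}
    (a : A ≅ A') (b : B ≅ B') (x : X ≅ X'), i ≫ b.hom = a.hom ≫ i' → p ≫ x.hom = b.hom ≫ p' →
    Ses i p → Ses i' p'
  id_monic : ∀ A : 𝒞, Ses.AdmissibleMonic (𝟙 A)
  id_epic : ∀ A : 𝒞, Ses.AdmissibleEpic (𝟙 A)
  comp_monic : ∀ {A B B' : 𝒞} {i : A ⟶ B} {j : B ⟶ B'},
    Ses.AdmissibleMonic i → Ses.AdmissibleMonic j → Ses.AdmissibleMonic (i ≫ j)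
  comp_epic : ∀ {B X X' : 𝒞} {p : B ⟶ X} {r : X ⟶ X'},
    Ses.AdmissibleEpic p → Ses.AdmissibleEpic r → Ses.AdmissibleEpic (p ≫ r)
  pushout : ∀ {A B X A' : 𝒞} {i : A ⟶ B} {p : B ⟶ X} (f : A ⟶ A'), Ses i p →
    ∃ (B' : 𝒞) (g : B ⟶ B') (i' : A' ⟶ B') (p' : B' ⟶ X),
      IsPushout i f g i' ∧ g ≫ p' = p ∧ Ses i' p'
  pullback : ∀ {A B X X' : 𝒞} {i : A ⟶ B} {p : B ⟶ X} (f : X' ⟶ X), Ses i p →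
    ∃ (B' : 𝒞) (g : B' ⟶ B) (i' : A ⟶ B') (p' : B' ⟶ X'),
      IsPullback g p' p f ∧ i' ≫ g = i ∧ Ses i' p'

namespace ExactStructure

section Basic

variable {𝒞 : Type u} [Category.{v} 𝒞] [Preadditive 𝒞] (E : ExactStructure 𝒞)

/-- A short exact sequence `A ⟶ B ⟶ X` with prescribed ends `A` and `X`. -/
structure Conflation (A X : 𝒞) where
  B : 𝒞
  i : A ⟶ B
  p : B ⟶ X
  ses : E.Ses i p

/-- Exact sequences `A ⟶ Bₙ ⟶ ⋯ ⟶ B₁ ⟶ X` of length `n`, given as splices `Eₙ ∘ ⋯ ∘ E₁` of short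
exact sequences `Eₖ : Zₖ ⟶ Bₖ ⟶ Zₖ₋₁` with `Zₙ = A` and `Z₀ = X`. There are none for `n = 0`. -/
inductive ExactSeq (A : 𝒞) : 𝒞 → ℕ → Type (max u v)
  | single {X : 𝒞} (S : E.Conflation A X) : ExactSeq A X (0 + 1)
  | splice {Z X : 𝒞} {n : ℕ} (T : ExactSeq A Z n) (S : E.Conflation Z X) : ExactSeq A X (n + 1)

variable {E}

namespace ExactSeq

/-- `IsMap a T T' x`: there is a morphism of exact sequences `T ⟶ T'` (a commutative ladder) with
leftmost component `a` and rightmost component `x`. -/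
inductive IsMap {A A' : 𝒞} (a : A ⟶ A') :
    ∀ {X X' : 𝒞} {n : ℕ}, E.ExactSeq A X n → E.ExactSeq A' X' n → (X ⟶ X') → Prop
  | single {X X' : 𝒞} (S : E.Conflation A X) (S' : E.Conflation A' X') (b : S.B ⟶ S'.B)
      (x : X ⟶ X') (hi : S.i ≫ b = a ≫ S'.i) (hp : S.p ≫ x = b ≫ S'.p) :
      IsMap a (.single S) (.single S') x
  | splice {X X' Z Z' : 𝒞} {n : ℕ} (T : E.ExactSeq A Z n) (T' : E.ExactSeq A' Z' n)
      (S : E.Conflation Z X) (S' : E.Conflation Z' X') (z : Z ⟶ Z') (b : S.B ⟶ S'.B)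
      (x : X ⟶ X') (hT : IsMap a T T' z) (hi : S.i ≫ b = z ≫ S'.i) (hp : S.p ≫ x = b ≫ S'.p) :
      IsMap a (.splice T S) (.splice T' S') x

end ExactSeq

variable (E) in
/-- The Yoneda extensions `Extⁿ(X, A)`: exact sequences `A ⟶ Bₙ ⟶ ⋯ ⟶ B₁ ⟶ X` modulo the
equivalence relation generated by the morphisms of exact sequences that are the identity on both
ends. -/
def Ext (n : ℕ) (X A : 𝒞) : Type (max u v) :=
  Quot fun T T' : E.ExactSeq A X n => ExactSeq.IsMap (𝟙 A) T T' (𝟙 X)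

/-- The class of an exact sequence in `Ext`. -/
def Ext.mk {n : ℕ} {X A : 𝒞} (T : E.ExactSeq A X n) : E.Ext n X A := Quot.mk _ T

/-- The pullback of a short exact sequence along a morphism. -/
noncomputable def Conflation.pull {A X X' : 𝒞} (S : E.Conflation A X) (f : X' ⟶ X) :
    E.Conflation A X' where
  B := (E.pullback f S.ses).choose
  i := (E.pullback f S.ses).choose_spec.choose_spec.choose
  p := (E.pullback f S.ses).choose_spec.choose_spec.choose_spec.choose
  ses := (E.pullback f S.ses).choose_spec.choose_spec.choose_spec.choose_spec.2.2

theorem Conflation.pull_spec {A X X' : 𝒞} (S : E.Conflation A X) (f : X' ⟶ X) :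
    ∃ g : (S.pull f).B ⟶ S.B, IsPullback g (S.pull f).p S.p f ∧ (S.pull f).i ≫ g = S.i :=
  ⟨(E.pullback f S.ses).choose_spec.choose,
    (E.pullback f S.ses).choose_spec.choose_spec.choose_spec.choose_spec.1,
    (E.pullback f S.ses).choose_spec.choose_spec.choose_spec.choose_spec.2.1⟩

/-- The pushout of a short exact sequence along a morphism. -/
noncomputable def Conflation.push {A A' X : 𝒞} (S : E.Conflation A X) (f : A ⟶ A') :
    E.Conflation A' X where
  B := (E.pushout f S.ses).choose
  i := (E.pushout f S.ses).choose_spec.choose_spec.choose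
  p := (E.pushout f S.ses).choose_spec.choose_spec.choose_spec.choose
  ses := (E.pushout f S.ses).choose_spec.choose_spec.choose_spec.choose_spec.2.2

theorem Conflation.push_spec {A A' X : 𝒞} (S : E.Conflation A X) (f : A ⟶ A') :
    ∃ g : S.B ⟶ (S.push f).B, IsPushout S.i f g (S.push f).i ∧ g ≫ (S.push f).p = S.p :=
  ⟨(E.pushout f S.ses).choose_spec.choose,
    (E.pushout f S.ses).choose_spec.choose_spec.choose_spec.choose_spec.1,
    (E.pushout f S.ses).choose_spec.choose_spec.choose_spec.choose_spec.2.1⟩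

theorem Conflation.zero {A X : 𝒞} (S : E.Conflation A X) : S.i ≫ S.p = 0 :=
  (E.kernel_cokernel S.ses).choose

theorem Conflation.mono {A X : 𝒞} (S : E.Conflation A X) : Mono S.i := by
  obtain ⟨w, ⟨h⟩, -⟩ := E.kernel_cokernel S.ses
  exact ⟨fun g h' e => Fork.IsLimit.hom_ext h e⟩

theorem Conflation.epi {A X : 𝒞} (S : E.Conflation A X) : Epi S.p := by
  obtain ⟨w, -, ⟨h⟩⟩ := E.kernel_cokernel S.ses
  exact ⟨fun g h' e => Cofork.IsColimit.hom_ext h e⟩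

theorem Conflation.pull_lift {A A' X X' Y : 𝒞} (S : E.Conflation A X) (S' : E.Conflation A' X')
    (f : Y ⟶ X') (a : A ⟶ A') (y : X ⟶ Y) (b : S.B ⟶ S'.B) (hi : S.i ≫ b = a ≫ S'.i)
    (hp : S.p ≫ (y ≫ f) = b ≫ S'.p) :
    ∃ b' : S.B ⟶ (S'.pull f).B, S.i ≫ b' = a ≫ (S'.pull f).i ∧
      S.p ≫ y = b' ≫ (S'.pull f).p := by
  obtain ⟨g, hg, hgi⟩ := S'.pull_spec f
  refine ⟨hg.lift b (S.p ≫ y) (by simp [hp]), hg.hom_ext ?_ ?_, by simp⟩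
  · simp [hi, hgi]
  · simp [(S'.pull f).zero, reassoc_of% S.zero]

theorem Conflation.push_desc {A A' A'' X X' : 𝒞} (S : E.Conflation A X)
    (S' : E.Conflation A'' X') (f : A ⟶ A') (c : A' ⟶ A'') (x : X ⟶ X') (b : S.B ⟶ S'.B)
    (hi : S.i ≫ b = (f ≫ c) ≫ S'.i) (hp : S.p ≫ x = b ≫ S'.p) :
    ∃ b' : (S.push f).B ⟶ S'.B, (S.push f).i ≫ b' = c ≫ S'.i ∧
      (S.push f).p ≫ x = b' ≫ S'.p := by
  obtain ⟨g, hg, hgp⟩ := S.push_spec f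
  refine ⟨hg.desc b (c ≫ S'.i) (by simp [hi]), by simp, hg.hom_ext ?_ ?_⟩
  · rw [← Category.assoc, hgp, ← Category.assoc, hg.inl_desc, hp]
  · rw [← Category.assoc, (S.push f).zero, ← Category.assoc, hg.inr_desc, Category.assoc, S'.zero]
    simp

namespace ExactSeq

/-- The pullback of an exact sequence along a morphism into its right end. -/
noncomputable def pull {A X X' : 𝒞} (f : X' ⟶ X) : ∀ {n : ℕ}, E.ExactSeq A X n → E.ExactSeq A X' n
  | _, .single S => .single (S.pull f)
  | _, .splice T S => .splice T (S.pull f)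

/-- The pushout of an exact sequence along a morphism out of its left end. -/
noncomputable def push {A A' : 𝒞} (f : A ⟶ A') :
    ∀ {X : 𝒞} {n : ℕ}, E.ExactSeq A X n → E.ExactSeq A' X n
  | _, _, .single S => .single (S.push f)
  | _, _, .splice T S => .splice (T.push f) S

theorem IsMap.id {A X : 𝒞} {n : ℕ} (T : E.ExactSeq A X n) : IsMap (𝟙 A) T T (𝟙 X) := by
  induction T with
  | single S => exact .single S S (𝟙 _) _ (by simp) (by simp)
  | splice T S ih => exact .splice T T S S (𝟙 _) (𝟙 _) _ ih (by simp) (by simp)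

theorem IsMap.comp {A A' A'' X X' X'' : 𝒞} {n : ℕ} {a : A ⟶ A'} {a' : A' ⟶ A''} {x : X ⟶ X'}
    {x' : X' ⟶ X''} {T : E.ExactSeq A X n} {T' : E.ExactSeq A' X' n} {T'' : E.ExactSeq A'' X'' n}
    (h : IsMap a T T' x) (h' : IsMap a' T' T'' x') : IsMap (a ≫ a') T T'' (x ≫ x') := by
  induction h generalizing X'' with
  | single S S' b x hi hp =>
    cases h' with
    | single _ S'' b' _ hi' hp' =>
      exact .single S S'' (b ≫ b') _ (by rw [reassoc_of% hi, hi', Category.assoc])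
        (by rw [reassoc_of% hp, hp', Category.assoc])
  | splice T T' S S' z b x hT hi hp ih =>
    cases h' with
    | splice _ T'' _ S'' z' b' _ hT' hi' hp' =>
      exact .splice T T'' S S'' (z ≫ z') (b ≫ b') _ (ih hT')
        (by rw [reassoc_of% hi, hi', Category.assoc])
        (by rw [reassoc_of% hp, hp', Category.assoc])

theorem IsMap.congr {A A' X X' : 𝒞} {n : ℕ} {a a' : A ⟶ A'} {x x' : X ⟶ X'}
    {T : E.ExactSeq A X n} {T' : E.ExactSeq A' X' n} (h : IsMap a T T' x) (ha : a = a')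
    (hx : x = x') : IsMap a' T T' x' := by
  subst ha hx; exact h

theorem pull_isMap {A X X' : 𝒞} (f : X' ⟶ X) {n : ℕ} (T : E.ExactSeq A X n) :
    IsMap (𝟙 A) (T.pull f) T f := by
  cases T with
  | single S =>
    obtain ⟨g, hg, hi⟩ := S.pull_spec f
    exact .single _ _ g f (by simp [hi]) hg.w.symm
  | splice T S =>
    obtain ⟨g, hg, hi⟩ := S.pull_spec f
    exact .splice _ _ _ _ (𝟙 _) g f (.id T) (by simp [hi]) hg.w.symm

theorem push_isMap {A A' X : 𝒞} (f : A ⟶ A') {n : ℕ} (T : E.ExactSeq A X n) :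
    IsMap f T (T.push f) (𝟙 X) := by
  induction T with
  | single S =>
    obtain ⟨g, hg, hp⟩ := S.push_spec f
    exact .single _ _ g _ hg.w (by simp [hp])
  | splice T S ih => exact .splice _ _ _ _ (𝟙 _) (𝟙 _) _ ih (by simp) (by simp)

theorem IsMap.pull_lift {A A' X X' Y : 𝒞} {n : ℕ} {T : E.ExactSeq A X n} {T' : E.ExactSeq A' X' n}
    {a : A ⟶ A'} {y : X ⟶ Y} {f : Y ⟶ X'} (h : IsMap a T T' (y ≫ f)) :
    IsMap a T (T'.pull f) y := by
  cases h with
  | single S S' b _ hi hp =>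
    obtain ⟨b', hi', hp'⟩ := Conflation.pull_lift S S' f a y b hi hp
    exact .single _ _ b' _ hi' hp'
  | splice T T' S S' z b _ hT hi hp =>
    obtain ⟨b', hi', hp'⟩ := Conflation.pull_lift S S' f z y b hi hp
    exact .splice _ _ _ _ z b' _ hT hi' hp'

theorem IsMap.push_desc {A A' A'' X X' : 𝒞} {n : ℕ} {T : E.ExactSeq A X n}
    {T' : E.ExactSeq A'' X' n} {f : A ⟶ A'} {c : A' ⟶ A''} {x : X ⟶ X'}
    (h : IsMap (f ≫ c) T T' x) : IsMap c (T.push f) T' x := by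
  induction h with
  | single S S' b x hi hp =>
    obtain ⟨b', hi', hp'⟩ := Conflation.push_desc S S' f c x b hi hp
    exact .single _ _ b' _ hi' hp'
  | splice T T' S S' z b x hT hi hp ih => exact .splice _ _ _ _ z b x ih hi hp

end ExactSeq

open ExactSeq

namespace Ext

theorem sound {n : ℕ} {X A : 𝒞} {T T' : E.ExactSeq A X n} (h : IsMap (𝟙 A) T T' (𝟙 X)) :
    mk T = mk T' := Quot.sound h

/-- `Extⁿ(f, A)`, induced by pullback along `f`. -/
noncomputable def pull {n : ℕ} {X X' A : 𝒞} (f : X' ⟶ X) : E.Ext n X A → E.Ext n X' A :=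
  Quot.map (fun T => T.pull f) fun _ _ h =>
    IsMap.pull_lift (((pull_isMap f _).comp h).congr (by simp) (by simp))

/-- `Extⁿ(X, f)`, induced by pushout along `f`. -/
noncomputable def push {n : ℕ} {X A A' : 𝒞} (f : A ⟶ A') : E.Ext n X A → E.Ext n X A' :=
  Quot.map (fun T => T.push f) fun _ _ h =>
    IsMap.push_desc ((h.comp (push_isMap f _)).congr (by simp) (by simp))

theorem push_eq_pull {n : ℕ} {X X' A A' : 𝒞} {T : E.ExactSeq A X n} {T' : E.ExactSeq A' X' n}
    {a : A ⟶ A'} {x : X ⟶ X'} (h : IsMap a T T' x) : push a (mk T) = pull x (mk T') :=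
  sound (IsMap.push_desc (IsMap.pull_lift (h.congr (Category.comp_id a).symm
    (Category.id_comp x).symm)))

theorem push_id {n : ℕ} {X A : 𝒞} (e : E.Ext n X A) : push (𝟙 A) e = e := by
  induction e using Quot.ind with
  | mk T => exact sound (IsMap.push_desc ((IsMap.id T).congr (by simp) rfl))

theorem pull_id {n : ℕ} {X A : 𝒞} (e : E.Ext n X A) : pull (𝟙 X) e = e := by
  induction e using Quot.ind with
  | mk T => exact sound (E := E) (pull_isMap (𝟙 X) T)

theorem push_push {n : ℕ} {X A A' A'' : 𝒞} (f : A ⟶ A') (g : A' ⟶ A'') (e : E.Ext n X A) :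
    push g (push f e) = push (f ≫ g) e := by
  induction e using Quot.ind with
  | mk T => exact (sound (IsMap.push_desc
      (((push_isMap f T).comp (push_isMap g _)).congr (by simp) (by simp)))).symm

theorem pull_pull {n : ℕ} {X X' X'' A : 𝒞} (f : X' ⟶ X) (g : X'' ⟶ X') (e : E.Ext n X A) :
    pull g (pull f e) = pull (g ≫ f) e := by
  induction e using Quot.ind with
  | mk T => exact sound (IsMap.pull_lift
      (((pull_isMap g _).comp (pull_isMap f T)).congr (by simp) (by simp)))

theorem push_pull {n : ℕ} {X X' A A' : 𝒞} (f : A ⟶ A') (x : X' ⟶ X) (e : E.Ext n X A) :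
    push f (pull x e) = pull x (push f e) := by
  induction e using Quot.ind with
  | mk T =>
    exact push_eq_pull (((pull_isMap x T).comp (push_isMap f T)).congr (by simp) (by simp))

theorem nonempty_exactSeq (E : ExactStructure 𝒞) (n : ℕ) (A X : 𝒞) :
    Nonempty (E.ExactSeq A X (n + 1)) := by
  induction n generalizing X with
  | zero =>
    obtain ⟨Z, i, h⟩ := E.id_epic X
    exact ⟨.single (Conflation.push ⟨X, i, 𝟙 X, h⟩ (0 : Z ⟶ A))⟩
  | succ n ih =>
    obtain ⟨Z, i, h⟩ := E.id_epic X
    obtain ⟨T⟩ := ih Z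
    exact ⟨.splice T ⟨X, i, 𝟙 X, h⟩⟩

end Ext

end Basic

section Additive

variable {𝒞 : Type u} [Category.{v} 𝒞] [Preadditive 𝒞] [HasBinaryBiproducts 𝒞]
  {E : ExactStructure 𝒞}

theorem monic_map_left {A B : 𝒞} {i : A ⟶ B} (hi : E.Ses.AdmissibleMonic i) (A' : 𝒞) :
    E.Ses.AdmissibleMonic (biprod.map i (𝟙 A')) := by
  obtain ⟨X, p, h⟩ := hi
  obtain ⟨B', g, i', p', hg, -, h'⟩ := E.pushout (biprod.inl : A ⟶ A ⊞ A') h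
  have sq : IsPushout i (biprod.inl : A ⟶ A ⊞ A') biprod.inl (biprod.map i (𝟙 A')) := by
    refine ⟨⟨by simp⟩, ⟨PushoutCocone.IsColimit.mk _
      (fun s => biprod.desc s.inl (biprod.inr ≫ s.inr)) (fun s => by simp) (fun s => ?_)
      (fun s m h₁ h₂ => ?_)⟩⟩
    · apply biprod.hom_ext'
      · simp [s.condition]
      · simp
    · apply biprod.hom_ext'
      · simpa using h₁
      · simp [← h₂]
  refine ⟨X, (hg.isoIsPushout _ _ sq).inv ≫ p', ?_⟩
  exact E.of_iso (Iso.refl _) (hg.isoIsPushout _ _ sq) (Iso.refl _) (by simp) (by simp) h'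

theorem monic_map_right {A B : 𝒞} {i : A ⟶ B} (hi : E.Ses.AdmissibleMonic i) (A' : 𝒞) :
    E.Ses.AdmissibleMonic (biprod.map (𝟙 A') i) := by
  obtain ⟨X, p, h⟩ := monic_map_left hi A'
  refine ⟨X, (biprod.braiding _ _).inv ≫ p, E.of_iso (biprod.braiding _ _) (biprod.braiding _ _)
    (Iso.refl _) ?_ (by simp) h⟩
  apply biprod.hom_ext <;> simp

theorem ses_sum {A B X A' B' X' : 𝒞} {i : A ⟶ B} {p : B ⟶ X} {i' : A' ⟶ B'} {p' : B' ⟶ X'}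
    (h : E.Ses i p) (h' : E.Ses i' p') : E.Ses (biprod.map i i') (biprod.map p p') := by
  have hm : E.Ses.AdmissibleMonic (biprod.map i i') := by
    have := E.comp_monic (monic_map_left ⟨X, p, h⟩ A') (monic_map_right ⟨X', p', h'⟩ B)
    rwa [show biprod.map i (𝟙 A') ≫ biprod.map (𝟙 B) i' = biprod.map i i' by
      apply biprod.hom_ext <;> simp] at this
  obtain ⟨Y, r, hr⟩ := hm
  obtain ⟨wr, -, ⟨cr⟩⟩ := E.kernel_cokernel hr
  obtain ⟨w, -, ⟨c⟩⟩ := E.kernel_cokernel h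
  obtain ⟨w', -, ⟨c'⟩⟩ := E.kernel_cokernel h'
  have ws : biprod.map i i' ≫ biprod.map p p' = 0 := by
    apply biprod.hom_ext <;> simp [w, w']
  have hep : Epi (biprod.map p p') := by
    have hp : Epi p := Conflation.epi ⟨B, i, p, h⟩
    have hp' : Epi p' := Conflation.epi ⟨B', i', p', h'⟩
    refine ⟨fun k l e => biprod.hom_ext' _ _ ?_ ?_⟩
    · rw [← cancel_epi p]
      simpa using biprod.inl ≫= e
    · rw [← cancel_epi p']
      simpa using biprod.inr ≫= e
  have cs : IsColimit (CokernelCofork.ofπ (biprod.map p p') ws) := by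
    refine CokernelCofork.IsColimit.ofπ' _ _ fun {Z} k hk => ?_
    have e₁ : i ≫ (biprod.inl ≫ k) = 0 := by
      have := biprod.inl ≫= hk
      simpa using this
    have e₂ : i' ≫ (biprod.inr ≫ k) = 0 := by
      have := biprod.inr ≫= hk
      simpa using this
    obtain ⟨l, hl⟩ := CokernelCofork.IsColimit.desc' c _ e₁
    obtain ⟨l', hl'⟩ := CokernelCofork.IsColimit.desc' c' _ e₂
    refine ⟨biprod.desc l l', ?_⟩
    have hl₁ : p ≫ l = biprod.inl ≫ k := hl
    have hl₂ : p' ≫ l' = biprod.inr ≫ k := hl'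
    apply biprod.hom_ext'
    · simp [hl₁]
    · simp [hl₂]
  exact E.of_iso (Iso.refl _) (Iso.refl _) (cr.coconePointUniqueUpToIso cs) (by simp)
    (by simpa using! cr.comp_coconePointUniqueUpToIso_hom cs WalkingParallelPair.one) hr

/-- The direct sum of two short exact sequences. -/
noncomputable def Conflation.sum {A A' X X' : 𝒞} (S : E.Conflation A X) (S' : E.Conflation A' X') :
    E.Conflation (A ⊞ A') (X ⊞ X') :=
  ⟨S.B ⊞ S'.B, biprod.map S.i S'.i, biprod.map S.p S'.p, ses_sum S.ses S'.ses⟩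

open ExactSeq

/-- The direct sum of two exact sequences of the same length. -/
noncomputable def ExactSeq.sum {A A' : 𝒞} : ∀ {X X' : 𝒞} {n : ℕ},
    E.ExactSeq A X n → E.ExactSeq A' X' n → E.ExactSeq (A ⊞ A') (X ⊞ X') n
  | _, _, _, .single S, .single S' => .single (S.sum S')
  | _, _, _, .splice T S, .splice T' S' => .splice (T.sum T') (S.sum S')

theorem ExactSeq.sum_fst {A A' X X' : 𝒞} {n : ℕ} (T : E.ExactSeq A X n)
    (T' : E.ExactSeq A' X' n) : IsMap biprod.fst (T.sum T') T biprod.fst := by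
  induction T generalizing X' with
  | single S =>
    cases T' with
    | single S' =>
      exact .single _ _ (biprod.fst : S.B ⊞ S'.B ⟶ S.B) _ (by simp [Conflation.sum])
        (by simp [Conflation.sum])
    | splice T' => nomatch T'
  | splice T S ih =>
    cases T' with
    | single => nomatch T
    | splice T' S' =>
      exact .splice _ _ _ _ biprod.fst (biprod.fst : S.B ⊞ S'.B ⟶ S.B) _ (ih T')
        (by simp [Conflation.sum])
        (by simp [Conflation.sum])

theorem ExactSeq.sum_snd {A A' X X' : 𝒞} {n : ℕ} (T : E.ExactSeq A X n)
    (T' : E.ExactSeq A' X' n) : IsMap biprod.snd (T.sum T') T' biprod.snd := by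
  induction T generalizing X' with
  | single S =>
    cases T' with
    | single S' =>
      exact .single _ _ (biprod.snd : S.B ⊞ S'.B ⟶ S'.B) _ (by simp [Conflation.sum])
        (by simp [Conflation.sum])
    | splice T' => nomatch T'
  | splice T S ih =>
    cases T' with
    | single => nomatch T
    | splice T' S' =>
      exact .splice _ _ _ _ biprod.snd (biprod.snd : S.B ⊞ S'.B ⟶ S'.B) _ (ih T')
        (by simp [Conflation.sum])
        (by simp [Conflation.sum])

theorem ExactSeq.sum_inl {A A' X X' : 𝒞} {n : ℕ} (T : E.ExactSeq A X n)
    (T' : E.ExactSeq A' X' n) : IsMap biprod.inl T (T.sum T') biprod.inl := by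
  induction T generalizing X' with
  | single S =>
    cases T' with
    | single S' =>
      exact .single _ _ (biprod.inl : S.B ⟶ S.B ⊞ S'.B) _ (by simp [Conflation.sum])
        (by simp [Conflation.sum])
    | splice T' => nomatch T'
  | splice T S ih =>
    cases T' with
    | single => nomatch T
    | splice T' S' =>
      exact .splice _ _ _ _ biprod.inl (biprod.inl : S.B ⟶ S.B ⊞ S'.B) _ (ih T')
        (by simp [Conflation.sum])
        (by simp [Conflation.sum])

theorem ExactSeq.sum_inr {A A' X X' : 𝒞} {n : ℕ} (T : E.ExactSeq A X n)
    (T' : E.ExactSeq A' X' n) : IsMap biprod.inr T' (T.sum T') biprod.inr := by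
  induction T generalizing X' with
  | single S =>
    cases T' with
    | single S' =>
      exact .single _ _ (biprod.inr : S'.B ⟶ S.B ⊞ S'.B) _ (by simp [Conflation.sum])
        (by simp [Conflation.sum])
    | splice T' => nomatch T'
  | splice T S ih =>
    cases T' with
    | single => nomatch T
    | splice T' S' =>
      exact .splice _ _ _ _ biprod.inr (biprod.inr : S'.B ⟶ S.B ⊞ S'.B) _ (ih T')
        (by simp [Conflation.sum])
        (by simp [Conflation.sum])

theorem ExactSeq.IsMap.lift {A A' A'' X X' X'' : 𝒞} {n : ℕ} {a : A'' ⟶ A} {a' : A'' ⟶ A'}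
    {x : X'' ⟶ X} {x' : X'' ⟶ X'} {Y : E.ExactSeq A'' X'' n} {T : E.ExactSeq A X n}
    {T' : E.ExactSeq A' X' n} (h : IsMap a Y T x) (h' : IsMap a' Y T' x') :
    IsMap (biprod.lift a a') Y (T.sum T') (biprod.lift x x') := by
  induction h generalizing X' with
  | single S S₁ b x hi hp =>
    cases h' with
    | single _ S₂ b' _ hi' hp' =>
      refine .single _ _ (biprod.lift b b' : S.B ⟶ S₁.B ⊞ S₂.B) _ ?_ ?_
      · exact biprod.hom_ext _ _ (by simp [Conflation.sum, hi]) (by simp [Conflation.sum, hi'])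
      · exact biprod.hom_ext _ _ (by simp [Conflation.sum, hp]) (by simp [Conflation.sum, hp'])
  | splice T T₁ S S₁ z b x hT hi hp ih =>
    cases h' with
    | splice _ T₂ _ S₂ z' b' _ hT' hi' hp' =>
      refine .splice _ _ _ _ _ (biprod.lift b b' : S.B ⟶ S₁.B ⊞ S₂.B) _ (ih hT') ?_ ?_
      · exact biprod.hom_ext _ _ (by simp [Conflation.sum, hi]) (by simp [Conflation.sum, hi'])
      · exact biprod.hom_ext _ _ (by simp [Conflation.sum, hp]) (by simp [Conflation.sum, hp'])

theorem ExactSeq.IsMap.desc {A A' A'' X X' X'' : 𝒞} {n : ℕ} {a : A ⟶ A''} {a' : A' ⟶ A''}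
    {x : X ⟶ X''} {x' : X' ⟶ X''} {Y : E.ExactSeq A'' X'' n} {T : E.ExactSeq A X n}
    {T' : E.ExactSeq A' X' n} (h : IsMap a T Y x) (h' : IsMap a' T' Y x') :
    IsMap (biprod.desc a a') (T.sum T') Y (biprod.desc x x') := by
  induction h generalizing X' with
  | single S₁ S b x hi hp =>
    cases h' with
    | single S₂ _ b' _ hi' hp' =>
      refine .single _ _ (biprod.desc b b' : S₁.B ⊞ S₂.B ⟶ S.B) _ ?_ ?_
      · exact biprod.hom_ext' _ _ (by simp [Conflation.sum, hi]) (by simp [Conflation.sum, hi'])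
      · exact biprod.hom_ext' _ _ (by simp [Conflation.sum, hp]) (by simp [Conflation.sum, hp'])
  | splice T₁ T S₁ S z b x hT hi hp ih =>
    cases h' with
    | splice T₂ _ S₂ _ z' b' _ hT' hi' hp' =>
      refine .splice _ _ _ _ _ (biprod.desc b b' : S₁.B ⊞ S₂.B ⟶ S.B) _ (ih hT') ?_ ?_
      · exact biprod.hom_ext' _ _ (by simp [Conflation.sum, hi]) (by simp [Conflation.sum, hi'])
      · exact biprod.hom_ext' _ _ (by simp [Conflation.sum, hp]) (by simp [Conflation.sum, hp'])

namespace Ext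

/-- The direct sum of two extension classes. -/
noncomputable def sum {n : ℕ} {X X' A A' : 𝒞} :
    E.Ext n X A → E.Ext n X' A' → E.Ext n (X ⊞ X') (A ⊞ A') :=
  Quot.map₂ ExactSeq.sum
    (fun T T₁ T₂ h => (((sum_fst T T₁).lift ((sum_snd T T₁).comp h))).congr
      (by apply biprod.hom_ext <;> simp) (by apply biprod.hom_ext <;> simp))
    (fun T₁ T₂ T h => ((((sum_fst T₁ T).comp h).lift (sum_snd T₁ T))).congr
      (by apply biprod.hom_ext <;> simp) (by apply biprod.hom_ext <;> simp))

/-- The Baer sum: the direct sum, pushed out along the codiagonal and pulled back along the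
diagonal. -/
noncomputable instance {n : ℕ} {X A : 𝒞} : Add (E.Ext n X A) :=
  ⟨fun e e' => pull (biprod.lift (𝟙 X) (𝟙 X)) (push (biprod.desc (𝟙 A) (𝟙 A)) (sum e e'))⟩

theorem add_def {n : ℕ} {X A : 𝒞} (e e' : E.Ext n X A) :
    e + e' = pull (biprod.lift (𝟙 X) (𝟙 X)) (push (biprod.desc (𝟙 A) (𝟙 A)) (sum e e')) := rfl

theorem push_add_push {n : ℕ} {X A A' : 𝒞} (a b : A ⟶ A') (e : E.Ext n X A) :
    push a e + push b e = push (a + b) e := by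
  induction e using Quot.ind with
  | mk T =>
    have h := push_eq_pull ((push_isMap a T).lift (push_isMap b T))
    rw [add_def, ← push_pull]
    refine (congrArg _ h.symm).trans ?_
    rw [push_push]
    congr 1
    simp

theorem pull_add_pull {n : ℕ} {X X' A : 𝒞} (a b : X' ⟶ X) (e : E.Ext n X A) :
    pull a e + pull b e = pull (a + b) e := by
  induction e using Quot.ind with
  | mk T =>
    have h : IsMap (biprod.desc (𝟙 A) (𝟙 A)) ((T.pull a).sum (T.pull b)) T (biprod.desc a b) :=
      (pull_isMap a T).desc (pull_isMap b T)
    rw [add_def]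
    refine (congrArg _ (push_eq_pull h)).trans ?_
    rw [pull_pull]
    congr 1
    simp

theorem exists_push {n : ℕ} {X A A' : 𝒞} (e : E.Ext n X A) (e' : E.Ext n X A') :
    ∃ w : E.Ext n X (A ⊞ A'), push biprod.fst w = e ∧ push biprod.snd w = e' := by
  induction e using Quot.ind with
  | mk T =>
    induction e' using Quot.ind with
    | mk T' =>
      refine ⟨pull (biprod.lift (𝟙 X) (𝟙 X)) (mk (T.sum T')), ?_, ?_⟩
      · rw [push_pull, push_eq_pull (sum_fst T T'), pull_pull, biprod.lift_fst, pull_id]; rfl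
      · rw [push_pull, push_eq_pull (sum_snd T T'), pull_pull, biprod.lift_snd, pull_id]; rfl

theorem exists_pull {n : ℕ} {X X' A : 𝒞} (e : E.Ext n X A) (e' : E.Ext n X' A) :
    ∃ w : E.Ext n (X ⊞ X') A, pull biprod.inl w = e ∧ pull biprod.inr w = e' := by
  induction e using Quot.ind with
  | mk T =>
    induction e' using Quot.ind with
    | mk T' =>
      refine ⟨push (biprod.desc (𝟙 A) (𝟙 A)) (mk (T.sum T')), ?_, ?_⟩
      · rw [← push_pull, ← push_eq_pull (sum_inl T T'), push_push, biprod.inl_desc, push_id]; rfl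
      · rw [← push_pull, ← push_eq_pull (sum_inr T T'), push_push, biprod.inr_desc, push_id]; rfl

theorem push_add {n : ℕ} {X A A' : 𝒞} (f : A ⟶ A') (e e' : E.Ext n X A) :
    push f (e + e') = push f e + push f e' := by
  obtain ⟨w, rfl, rfl⟩ := exists_push e e'
  simp only [push_add_push, push_push, Preadditive.add_comp]

theorem pull_add {n : ℕ} {X X' A : 𝒞} (f : X' ⟶ X) (e e' : E.Ext n X A) :
    pull f (e + e') = pull f e + pull f e' := by
  obtain ⟨w, rfl, rfl⟩ := exists_pull e e'
  simp only [pull_add_pull, pull_pull, Preadditive.comp_add]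

theorem push_zero_eq {n : ℕ} {X A A' : 𝒞} (e e' : E.Ext n X A) :
    push (0 : A ⟶ A') e = push (0 : A ⟶ A') e' := by
  obtain ⟨w, rfl, rfl⟩ := exists_push e e'
  simp [push_push]

/-- The zero class, the image of any class under the zero morphism. -/
noncomputable instance {n : ℕ} {X A : 𝒞} : Zero (E.Ext (n + 1) X A) :=
  ⟨push (0 : A ⟶ A) (mk (nonempty_exactSeq E n A X).some)⟩

theorem push_zero {n : ℕ} {X A : 𝒞} (e : E.Ext (n + 1) X A) : push (0 : A ⟶ A) e = 0 :=
  push_zero_eq _ _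

theorem add_comm' {n : ℕ} {X A : 𝒞} (e e' : E.Ext n X A) : e + e' = e' + e := by
  obtain ⟨w, rfl, rfl⟩ := exists_push e e'
  rw [push_add_push, push_add_push, add_comm biprod.fst]

theorem zero_add' {n : ℕ} {X A : 𝒞} (e : E.Ext (n + 1) X A) : 0 + e = e := by
  have h := push_add_push (0 : A ⟶ A) (𝟙 A) e
  rwa [push_zero, push_id, zero_add, push_id] at h

noncomputable instance {n : ℕ} {X A : 𝒞} : Neg (E.Ext n X A) := ⟨push (-𝟙 A)⟩

/-- The abelian group `Extⁿ(X, A)` for `n ≥ 1` (written `n + 1`), under the Baer sum. -/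
noncomputable instance {n : ℕ} {X A : 𝒞} : AddCommGroup (E.Ext (n + 1) X A) where
  add_assoc e e' e'' := by
    obtain ⟨w, h, rfl⟩ := exists_push e e'
    obtain ⟨w, rfl, rfl⟩ := exists_push w e''
    subst h
    simp only [push_add_push, push_push, add_assoc]
  zero_add := zero_add'
  add_zero e := (add_comm' e 0).trans (zero_add' e)
  nsmul := nsmulRec
  zsmul := zsmulRec
  neg_add_cancel e := by
    have h := push_add_push (-𝟙 A) (𝟙 A) e
    rwa [neg_add_cancel, push_zero, push_id] at h
  add_comm := add_comm'

end Ext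

end Additive

section Functor

variable {𝒞 : Type u₁} [Category.{v₁} 𝒞] [Preadditive 𝒞]
  {𝒟 : Type u₂} [Category.{v₂} 𝒟] [Preadditive 𝒟]
  {E : ExactStructure 𝒞} (E' : ExactStructure 𝒟) (R : 𝒞 ⥤ 𝒟)

/-- The functor `R` preserves the given exact sequence: it sends the short exact sequences of which
the sequence is spliced to short exact sequences. (If `R` preserves kernels or cokernels, for instance
if it is a right or a left adjoint, this says that the image of the sequence is exact.) -/
def ExactSeq.IsPreserved {A : 𝒞} : ∀ {X : 𝒞} {n : ℕ}, E.ExactSeq A X n → Prop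
  | _, _, .single S => E'.Ses (R.map S.i) (R.map S.p)
  | _, _, .splice T S => T.IsPreserved ∧ E'.Ses (R.map S.i) (R.map S.p)

/-- The image under `R` of an exact sequence that `R` preserves. -/
def ExactSeq.map {A : 𝒞} : ∀ {X : 𝒞} {n : ℕ} (T : E.ExactSeq A X n), T.IsPreserved E' R →
    E'.ExactSeq (R.obj A) (R.obj X) n
  | _, _, .single S, h => .single ⟨R.obj S.B, R.map S.i, R.map S.p, h⟩
  | _, _, .splice T S, h => .splice (T.map h.1) ⟨R.obj S.B, R.map S.i, R.map S.p, h.2⟩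

open ExactSeq

variable {E' R}

theorem ExactSeq.IsMap.map {A A' X X' : 𝒞} {n : ℕ} {a : A ⟶ A'} {x : X ⟶ X'}
    {T : E.ExactSeq A X n} {T' : E.ExactSeq A' X' n} (h : IsMap a T T' x)
    (hT : T.IsPreserved E' R) (hT' : T'.IsPreserved E' R) :
    IsMap (R.map a) (T.map E' R hT) (T'.map E' R hT') (R.map x) := by
  induction h with
  | single S S' b x hi hp =>
    exact .single _ _ (R.map b) _ (by simp only [← R.map_comp, hi]) (by simp only [← R.map_comp, hp])
  | splice T T' S S' z b x hz hi hp ih =>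
    exact .splice _ _ _ _ (R.map z) (R.map b) _ (ih hT.1 hT'.1) (by simp only [← R.map_comp, hi])
      (by simp only [← R.map_comp, hp])

variable (E E' R)

/-- The functor `R` preserves the exact sequences in `Extⁿ(X, -)`. -/
def PreservesExtFrom (n : ℕ) (X : 𝒞) : Prop :=
  ∀ (A : 𝒞) (T : E.ExactSeq A X n), T.IsPreserved E' R

/-- The functor `R` preserves the exact sequences in `Extⁿ(-, A)`. -/
def PreservesExtTo (n : ℕ) (A : 𝒞) : Prop :=
  ∀ (X : 𝒞) (T : E.ExactSeq A X n), T.IsPreserved E' R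

/-- The functor `R` restricted to the class `F` is exact: it preserves the short exact sequences all
of whose terms lie in `F`. -/
def ExactOn (F : ObjectProperty 𝒞) : Prop :=
  ∀ ⦃A B X : 𝒞⦄ (i : A ⟶ B) (p : B ⟶ X), F A → F B → F X → E.Ses i p →
    E'.Ses (R.map i) (R.map p)

end Functor

section Comparison

variable {𝒞 : Type u₁} [Category.{v₁} 𝒞] [Preadditive 𝒞]
  {𝒟 : Type u₂} [Category.{v₂} 𝒟] [Preadditive 𝒟]
  {E : ExactStructure 𝒞} {E' : ExactStructure 𝒟} {q : 𝒞 ⥤ 𝒟} {t : 𝒟 ⥤ 𝒞} (adj : q ⊣ t)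

open ExactSeq Ext

/-- The map `Extⁿ(q(X), A) → Extⁿ(X, t(A))` sending the class of `T` to the class of the pullback of
`t(T)` along the unit `X ⟶ t(q(X))`. -/
noncomputable def thetaFun {n : ℕ} {X : 𝒞} (h : PreservesExtFrom E' E t n (q.obj X)) (A : 𝒟) :
    E'.Ext n (q.obj X) A → E.Ext n X (t.obj A) :=
  Quot.map (fun T => (T.map E t (h A T)).pull (adj.unit.app X)) fun T T' hT =>
    IsMap.pull_lift (((pull_isMap _ _).comp (hT.map (h A T) (h A T'))).congr (by simp) (by simp))

/-- The map `Extⁿ(X, t(A)) → Extⁿ(q(X), A)` sending the class of `T` to the class of the pushout of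
`q(T)` along the counit `q(t(A)) ⟶ A`. -/
noncomputable def omegaFun {n : ℕ} {A : 𝒟} (h : PreservesExtTo E E' q n (t.obj A)) (X : 𝒞) :
    E.Ext n X (t.obj A) → E'.Ext n (q.obj X) A :=
  Quot.map (fun T => (T.map E' q (h X T)).push (adj.counit.app A)) fun T T' hT =>
    IsMap.push_desc (((hT.map (h X T) (h X T')).comp (push_isMap _ _)).congr (by simp) (by simp))

/-- `Θⁿ` is natural in `A`. -/
theorem thetaFun_push {n : ℕ} {X : 𝒞} (h : PreservesExtFrom E' E t n (q.obj X)) {A A' : 𝒟}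
    (f : A ⟶ A') (e : E'.Ext n (q.obj X) A) :
    thetaFun adj h A' (push f e) = push (t.map f) (thetaFun adj h A e) := by
  induction e using Quot.ind with
  | mk T =>
    refine (sound (IsMap.push_desc (IsMap.pull_lift ?_))).symm
    exact ((pull_isMap _ _).comp ((push_isMap f T).map (h A T) (h A' (T.push f)))).congr
      (by simp) (by simp)

/-- `Ωⁿ` is natural in `X`. -/
theorem omegaFun_pull {n : ℕ} {A : 𝒟} (h : PreservesExtTo E E' q n (t.obj A)) {X X' : 𝒞}
    (f : X' ⟶ X) (e : E.Ext n X (t.obj A)) :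
    omegaFun adj h X' (pull f e) = pull (q.map f) (omegaFun adj h X e) := by
  induction e using Quot.ind with
  | mk T =>
    refine sound (IsMap.push_desc (IsMap.pull_lift ?_))
    exact (((pull_isMap f T).map (h X' (T.pull f)) (h X T)).comp (push_isMap _ _)).congr
      (by simp) (by simp)

variable [HasZeroObject 𝒞] [HasBinaryBiproducts 𝒞] [HasZeroObject 𝒟] [HasBinaryBiproducts 𝒟]

/-- The homomorphisms `Θⁿ_X : Extⁿ(q(X), A) → Extⁿ(X, t(A))` (for `n ≥ 1`, written `n + 1`), defined
when `t` preserves the exact sequences in `Extⁿ(q(X), -)`. -/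
noncomputable def Theta {n : ℕ} {X : 𝒞} (h : PreservesExtFrom E' E t (n + 1) (q.obj X)) (A : 𝒟) :
    E'.Ext (n + 1) (q.obj X) A →+ E.Ext (n + 1) X (t.obj A) :=
  AddMonoidHom.mk' (thetaFun adj h A) fun e e' => by
    have := adj.isRightAdjoint
    have : Limits.PreservesLimitsOfSize.{0, 0} t := adj.rightAdjoint_preservesLimits
    have : t.Additive := Functor.additive_of_preserves_binary_products t
    obtain ⟨w, rfl, rfl⟩ := exists_push e e'
    simp only [push_add_push, thetaFun_push, Functor.map_add]

/-- The homomorphisms `Ωⁿ_A : Extⁿ(X, t(A)) → Extⁿ(q(X), A)` (for `n ≥ 1`, written `n + 1`), defined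
when `q` preserves the exact sequences in `Extⁿ(-, t(A))`. -/
noncomputable def Omega {n : ℕ} {A : 𝒟} (h : PreservesExtTo E E' q (n + 1) (t.obj A)) (X : 𝒞) :
    E.Ext (n + 1) X (t.obj A) →+ E'.Ext (n + 1) (q.obj X) A :=
  AddMonoidHom.mk' (omegaFun adj h X) fun e e' => by
    have := adj.isLeftAdjoint
    have : Limits.PreservesColimitsOfSize.{0, 0} q := adj.leftAdjoint_preservesColimits
    have := preservesBinaryBiproducts_of_preservesBinaryCoproducts q
    have : q.Additive := Functor.additive_of_preservesBinaryBiproducts q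
    obtain ⟨w, rfl, rfl⟩ := exists_pull e e'
    simp only [pull_add_pull, omegaFun_pull, Functor.map_add]

end Comparison

section Classes

variable {𝒞 : Type u} [Category.{v} 𝒞] [Preadditive 𝒞] (E : ExactStructure 𝒞)

/-- `F` is closed under extensions. -/
def ExtensionClosed (F : ObjectProperty 𝒞) : Prop :=
  ∀ ⦃A B X : 𝒞⦄ (i : A ⟶ B) (p : B ⟶ X), E.Ses i p → F A → F X → F B

/-- Every object is the target of an admissible epic from an object of `F`. -/
def Generating (F : ObjectProperty 𝒞) : Prop :=
  ∀ X : 𝒞, ∃ (B : 𝒞) (p : B ⟶ X), F B ∧ E.Ses.AdmissibleEpic p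

/-- Every object is the source of an admissible monic into an object of `F`. -/
def Cogenerating (F : ObjectProperty 𝒞) : Prop :=
  ∀ A : 𝒞, ∃ (B : 𝒞) (i : A ⟶ B), F B ∧ E.Ses.AdmissibleMonic i

/-- `F` is closed under kernels of admissible epics between objects of `F`. -/
def KernelClosed (F : ObjectProperty 𝒞) : Prop :=
  ∀ ⦃A B X : 𝒞⦄ (i : A ⟶ B) (p : B ⟶ X), E.Ses i p → F B → F X → F A

/-- `F` is closed under cokernels of admissible monics between objects of `F`. -/
def CokernelClosed (F : ObjectProperty 𝒞) : Prop :=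
  ∀ ⦃A B X : 𝒞⦄ (i : A ⟶ B) (p : B ⟶ X), E.Ses i p → F A → F B → F X

end Classes

end ExactStructure

/-! Only the statement about `t` and Θ needs a direct argument; the one about `q` and Ω is the same
statement for the adjunction between the opposite categories.

Preservation. The hypothesis forces `t` to be exact on all of the target category. For a short exact
sequence ending in `X`, cover `t(X)` by an object `Y` of the generating class, pull the sequence
back along the adjunct `q(Y) ⟶ X`, apply `t`, and pull back along the unit. The result shows that
`t(p)` becomes an admissible epic after precomposition. As `t(p)` has a kernel, `t` being a right
adjoint, the obscure axiom `ses_of_isLimit` makes `t(p)` itself an admissible epic. Longer sequences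
are preserved splice by splice.

Exactness of `q` gives bijectivity. Every exact sequence `U` from `t(A)` to an object `X` of the
class receives a map from a sequence `T` in the class that is the identity on `X`
(`ExactSeq.exists_resolution`). If its left component is `a`, the inverse of Θ sends `[U]` to the
pushout of `[q(T)]` along the adjunct of `a`. Two such resolutions have a common refinement in the
class, so the choice does not matter. Both inverse laws come from transporting ladders across the
adjunction.

Bijectivity gives exactness of `q`. Surjectivity of Θ¹ suffices. For a short exact sequence `K ⟶ B ⟶
X` in the class, the pushout along the unit of `K` is Θ¹ of some sequence `q(K) ⟶ E ⟶ q(X)`.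
Equality in Ext¹ is witnessed by a single ladder (`Ext.exists_isMap`), and its adjunct factors the
admissible monic `q(K) ⟶ E` through `q(B)`. Since `q` preserves cokernels, the dual obscure axiom
`ses_of_isColimit` finishes. -/

namespace ExactStructure

open Opposite

/-! ### The opposite exact structure. -/

section Op

variable {𝒞 : Type u} [Category.{v} 𝒞] [Preadditive 𝒞] (E : ExactStructure 𝒞)

theorem op_admissibleMonic {A B : 𝒞ᵒᵖ} {i : A ⟶ B} :
    SeqClass.AdmissibleMonic (fun _ _ _ i p => E.Ses p.unop i.unop) i ↔
      E.Ses.AdmissibleEpic i.unop :=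
  ⟨fun ⟨X, p, h⟩ => ⟨X.unop, p.unop, h⟩, fun ⟨X, p, h⟩ => ⟨op X, p.op, h⟩⟩

theorem op_admissibleEpic {B X : 𝒞ᵒᵖ} {p : B ⟶ X} :
    SeqClass.AdmissibleEpic (fun _ _ _ i p => E.Ses p.unop i.unop) p ↔
      E.Ses.AdmissibleMonic p.unop :=
  ⟨fun ⟨A, i, h⟩ => ⟨A.unop, i.unop, h⟩, fun ⟨A, i, h⟩ => ⟨op A, i.op, h⟩⟩

/-- The opposite exact structure. -/
def op : ExactStructure 𝒞ᵒᵖ where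
  Ses := fun _ _ _ i p => E.Ses p.unop i.unop
  kernel_cokernel {A B X i p} h := by
    obtain ⟨w, ⟨hk⟩, ⟨hc⟩⟩ := E.kernel_cokernel h
    exact ⟨Quiver.Hom.unop_inj w, ⟨CokernelCofork.IsColimit.ofπOp i.unop w hc⟩,
      ⟨KernelFork.IsLimit.ofιOp p.unop w hk⟩⟩
  of_iso {A B X A' B' X' i p i' p'} a b x hi hp h := by
    have h₁ : b.inv ≫ p = p' ≫ x.inv := by
      rw [Iso.inv_comp_eq, ← reassoc_of% hp, Iso.hom_inv_id, Category.comp_id]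
    have h₂ : a.inv ≫ i = i' ≫ b.inv := by
      rw [Iso.inv_comp_eq, ← reassoc_of% hi, Iso.hom_inv_id, Category.comp_id]
    exact E.of_iso x.unop.symm b.unop.symm a.unop.symm (congrArg Quiver.Hom.unop h₁)
      (congrArg Quiver.Hom.unop h₂) h
  id_monic A := (op_admissibleMonic E).2 (E.id_epic A.unop)
  id_epic A := (op_admissibleEpic E).2 (E.id_monic A.unop)
  comp_monic hi hj := (op_admissibleMonic E).2
    (E.comp_epic ((op_admissibleMonic E).1 hj) ((op_admissibleMonic E).1 hi))
  comp_epic hp hr := (op_admissibleEpic E).2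
    (E.comp_monic ((op_admissibleEpic E).1 hr) ((op_admissibleEpic E).1 hp))
  pushout f h := by
    obtain ⟨B', g, i', p', sq, hp, h'⟩ := E.pullback f.unop h
    exact ⟨.op B', g.op, p'.op, i'.op, sq.op.flip, congrArg Quiver.Hom.op hp, h'⟩
  pullback f h := by
    obtain ⟨B', g, i', p', sq, hp, h'⟩ := E.pushout f.unop h
    exact ⟨.op B', g.op, p'.op, i'.op, sq.op.flip, congrArg Quiver.Hom.op hp, h'⟩

end Op

/-! ### The short five lemma and equality in Ext¹. -/

section FiveLemma

variable {𝒞 : Type u} [Category.{v} 𝒞] [Preadditive 𝒞] {E : ExactStructure 𝒞}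

theorem admissibleEpic_of_isIso {B X : 𝒞} (f : B ⟶ X) [IsIso f] : E.Ses.AdmissibleEpic f := by
  obtain ⟨A, i, h⟩ := E.id_epic B
  exact ⟨A, i, E.of_iso (Iso.refl _) (Iso.refl _) (asIso f) (by simp) (by simp) h⟩

/-- A morphism of short exact sequences that is the identity on the ends is invertible. -/
theorem Conflation.exists_inverse {A X : 𝒞} (S S' : E.Conflation A X) (b : S.B ⟶ S'.B)
    (hi : S.i ≫ b = S'.i) (hp : S.p = b ≫ S'.p) :
    ∃ c : S'.B ⟶ S.B, S'.i ≫ c = S.i ∧ S'.p = c ≫ S.p := by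
  -- In terms of elements, `R` consists of pairs `(s, s')` with equal image in `X`. Below, `d` is
  -- the difference `b(s) - s'`, regarded in `A`, and `c` sends `s'` to `s - d(s, s')`, which does
  -- not depend on the choice of `s`.
  obtain ⟨R, g, j, r, sq, hj, hR⟩ := E.pullback S'.p S.ses
  obtain ⟨w', ⟨k'⟩, -⟩ := E.kernel_cokernel S'.ses
  obtain ⟨wr, ⟨kr⟩, ⟨cr⟩⟩ := E.kernel_cokernel hR
  have hepi : Epi r := Conflation.epi ⟨R, j, r, hR⟩
  have hmono := S'.mono
  obtain ⟨d, hd⟩ : ∃ d : R ⟶ A, d ≫ S'.i = g ≫ b - r := by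
    obtain ⟨a, ha⟩ := KernelFork.IsLimit.lift' k' (g ≫ b - r) (by simp [← hp, sq.w])
    exact ⟨a, ha⟩
  have hjd : j ≫ d = 𝟙 A := by
    rw [← cancel_mono S'.i]
    simp [hd, wr, reassoc_of% hj, hi]
  obtain ⟨c, hc⟩ : ∃ c : S'.B ⟶ S.B, r ≫ c = g - d ≫ S.i := by
    obtain ⟨a, ha⟩ := CokernelCofork.IsColimit.desc' cr (g - d ≫ S.i)
      (by simp [hj, reassoc_of% hjd])
    exact ⟨a, ha⟩
  refine ⟨c, ?_, ?_⟩
  · have h₁ : sq.lift 0 S'.i (by simp [w']) ≫ d = -𝟙 A := by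
      rw [← cancel_mono S'.i]
      simp [hd]
    have h₂ : sq.lift 0 S'.i (by simp [w']) ≫ r = S'.i := sq.lift_snd _ _ _
    rw [← h₂, Category.assoc, hc]
    simp [reassoc_of% h₁]
  · rw [← cancel_epi r, ← Category.assoc, hc]
    simp [S.zero, sq.w]

-- In length one the relation that generates `Ext` is already symmetric, by the short five lemma, so
-- the chain of ladders hidden in the quotient collapses to a single one.
open ExactSeq in
theorem Ext.exists_isMap {A X : 𝒞} {T T' : E.ExactSeq A X (0 + 1)}
    (h : Ext.mk T = Ext.mk T') : IsMap (𝟙 A) T T' (𝟙 X) := by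
  have h' := Quot.eqvGen_exact h
  induction h' with
  | rel _ _ h' => exact h'
  | refl => exact .id _
  | symm T T' _ ih =>
    cases ih (Quot.eqvGen_sound ‹_›) with
    | single S S' b _ hi hp =>
      obtain ⟨c, h₁, h₂⟩ := Conflation.exists_inverse S S' b (by simpa using hi)
        (by simpa using hp)
      exact .single _ _ c _ (by simpa using h₁) (by simpa using h₂)
    | splice T => nomatch T
  | trans _ _ _ _ _ h₁ h₂ =>
    exact ((h₁ (Quot.eqvGen_sound ‹_›)).comp (h₂ (Quot.eqvGen_sound ‹_›))).congr
      (by simp) (by simp)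

end FiveLemma

/-! ### The obscure axiom and its dual. -/

section Obscure

variable {𝒞 : Type u} [Category.{v} 𝒞] [Preadditive 𝒞] [HasBinaryBiproducts 𝒞]
  {E : ExactStructure 𝒞}

/-- The cokernel of `𝟙 B` is a zero object `Z`, so the sum of the two trivial sequences on `B` and
on `X` gives an admissible epic onto `Z ⊞ X ≅ X`. -/
theorem admissibleEpic_snd (B X : 𝒞) : E.Ses.AdmissibleEpic (biprod.snd : B ⊞ X ⟶ X) := by
  obtain ⟨Z, z, hz⟩ := E.id_monic B
  obtain ⟨Z', z', hz'⟩ := E.id_epic X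
  have h : E.Ses.AdmissibleEpic (biprod.map z (𝟙 X)) := ⟨_, _, ses_sum hz hz'⟩
  have hZ : IsZero Z := by
    have he : Epi z := Conflation.epi ⟨B, _, _, hz⟩
    have h0 : z = 0 := by simpa using Conflation.zero ⟨B, _, _, hz⟩
    rw [IsZero.iff_id_eq_zero, ← cancel_epi z, h0]
    simp
  have : IsIso (biprod.snd : Z ⊞ X ⟶ X) := (isoZeroBiprod hZ).isIso_inv
  have := E.comp_epic h (admissibleEpic_of_isIso (biprod.snd : Z ⊞ X ⟶ X))
  rwa [biprod.map_snd, Category.comp_id] at this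

/-- The automorphism of `A ⊞ B` given by a morphism `A ⟶ B`. -/
noncomputable def shear {A B : 𝒞} (f : A ⟶ B) : A ⊞ B ≅ A ⊞ B where
  hom := biprod.lift biprod.fst (biprod.fst ≫ f + biprod.snd)
  inv := biprod.lift biprod.fst (biprod.snd - biprod.fst ≫ f)
  hom_inv_id := by apply biprod.hom_ext <;> simp
  inv_hom_id := by apply biprod.hom_ext <;> simp

/-- A morphism with a kernel is an admissible epic if some composite `f ≫ p` is one. -/
theorem ses_of_isLimit {A B X Y : 𝒞} {i : A ⟶ B} {p : B ⟶ X} {w : i ≫ p = 0}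
    (hk : IsLimit (KernelFork.ofι i w)) (f : Y ⟶ B) (hf : E.Ses.AdmissibleEpic (f ≫ p)) :
    E.Ses i p := by
  have hfst : E.Ses.AdmissibleEpic ((biprod.fst : B ⊞ Y ⟶ B) ≫ p) := by
    obtain ⟨Z, z, hz⟩ := E.id_epic B
    obtain ⟨K, k, hk⟩ := hf
    have h₁ : E.Ses.AdmissibleEpic (biprod.map (𝟙 B) (f ≫ p)) := ⟨_, _, ses_sum hz hk⟩
    -- The composite sends `(b, y)` first to `(b - f y, y)`, then to `(b - f y, p f y)`, then to `(b
    -- - f y, p b)`, and finally to `p b`.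
    have h₂ := E.comp_epic (E.comp_epic (E.comp_epic (admissibleEpic_of_isIso
      ((biprod.braiding B Y).hom ≫ (shear (-f)).hom ≫ (biprod.braiding Y B).hom)) h₁)
      (admissibleEpic_of_isIso (shear p).hom)) (admissibleEpic_snd B X)
    convert h₂ using 1
    apply biprod.hom_ext' <;> simp [shear]
  obtain ⟨J, j, hj⟩ := hfst
  obtain ⟨wj, ⟨kj⟩, -⟩ := E.kernel_cokernel hj
  obtain ⟨a, ha⟩ : ∃ a : J ⟶ A, a ≫ i = j ≫ biprod.fst := by
    obtain ⟨a, ha⟩ := KernelFork.IsLimit.lift' hk (j ≫ biprod.fst) (by simpa using wj)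
    exact ⟨a, ha⟩
  obtain ⟨y, hy⟩ : ∃ y : Y ⟶ J, y ≫ j = biprod.inr := by
    obtain ⟨a, ha⟩ := KernelFork.IsLimit.lift' kj biprod.inr (by simp)
    exact ⟨a, ha⟩
  obtain ⟨m, hm⟩ : ∃ m : A ⟶ J, m ≫ j = i ≫ biprod.inl := by
    obtain ⟨a, ha⟩ := KernelFork.IsLimit.lift' kj (i ≫ biprod.inl) (by simp [w])
    exact ⟨a, ha⟩
  have hmono : Mono i := ⟨fun g h' e => Fork.IsLimit.hom_ext hk e⟩
  have hya : y ≫ a = 0 := by rw [← cancel_mono i]; simp [ha, reassoc_of% hy]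
  have hma : m ≫ a = 𝟙 A := by rw [← cancel_mono i]; simp [ha, reassoc_of% hm]
  -- The kernel `J` of `(b, y) ↦ p b` is morally `A ⊞ Y`, and `a` is the projection that kills `Y`.
  -- Pushing out along it removes `Y` from `B ⊞ Y` and leaves `i`, so the pushout axiom yields the
  -- required sequence.
  have sq : IsPushout j a biprod.fst i := by
    refine ⟨⟨ha.symm⟩, ⟨PushoutCocone.IsColimit.mk _ (fun s => biprod.inl ≫ s.inl)
      (fun s => ?_) (fun s => ?_) (fun s n h₁ h₂ => ?_)⟩⟩
    · apply biprod.hom_ext'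
      · simp
      · rw [← hy]
        simp [s.condition, reassoc_of% hya, reassoc_of% hy]
    · rw [← reassoc_of% hm, s.condition, reassoc_of% hma]
    · rw [← h₁, biprod.inl_fst_assoc]
  obtain ⟨B', g, i', p', hg, hp', h'⟩ := E.pushout a hj
  refine E.of_iso (Iso.refl _) (hg.isoIsPushout _ _ sq) (Iso.refl _) (by simp) ?_ h'
  refine hg.hom_ext ?_ ?_
  · simp [hp']
  · simp [w, Conflation.zero ⟨B', i', p', h'⟩]

/-- A morphism with a cokernel is an admissible monic if some composite `i ≫ f` is one. -/
theorem ses_of_isColimit {A B X Y : 𝒞} {i : A ⟶ B} {p : B ⟶ X} {w : i ≫ p = 0}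
    (hc : IsColimit (CokernelCofork.ofπ p w)) (f : B ⟶ Y) (hf : E.Ses.AdmissibleMonic (i ≫ f)) :
    E.Ses i p :=
  ses_of_isLimit (E := E.op) (i := p.op) (p := i.op) (CokernelCofork.IsColimit.ofπOp p w hc) f.op
    ((op_admissibleEpic E).2 hf)

end Obscure

open ExactSeq

/-! ### Resolving exact sequences by a generating class. -/

section Resolution

variable {𝒞 : Type u} [Category.{v} 𝒞] [Preadditive 𝒞] {E : ExactStructure 𝒞}

/-- The middle terms and the syzygies (including both ends) of the sequence lie in `F`. -/
def ExactSeq.TermsIn (F : ObjectProperty 𝒞) {A : 𝒞} : ∀ {X : 𝒞} {n : ℕ}, E.ExactSeq A X n → Prop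
  | X, _, .single S => F A ∧ F S.B ∧ F X
  | X, _, .splice T S => T.TermsIn F ∧ F S.B ∧ F X

variable {F : ObjectProperty 𝒞}

theorem ExactSeq.TermsIn.right {A X : 𝒞} {n : ℕ} {T : E.ExactSeq A X n} (h : T.TermsIn F) :
    F X := by
  cases T with
  | single S => exact h.2.2
  | splice T S => exact h.2.2

/-- Cover `P` by an object of `F` and take the kernel of the composite onto `X`; the universal
property of `S.i` supplies the map of kernels. -/
theorem Conflation.exists_of_generating (hgen : E.Generating F) {A X P : 𝒞}
    (S : E.Conflation A X) (p : P ⟶ S.B) (hp : E.Ses.AdmissibleEpic (p ≫ S.p)) :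
    ∃ (K : 𝒞) (S' : E.Conflation K X) (r : S'.B ⟶ P) (k : K ⟶ A), F S'.B ∧
      E.Ses.AdmissibleEpic r ∧ S'.p = r ≫ p ≫ S.p ∧ S'.i ≫ r ≫ p = k ≫ S.i := by
  obtain ⟨B, r, hB, hr⟩ := hgen P
  obtain ⟨K, i, h⟩ := E.comp_epic hr hp
  obtain ⟨w, ⟨hk⟩, -⟩ := E.kernel_cokernel S.ses
  obtain ⟨k, hk⟩ := KernelFork.IsLimit.lift' hk (i ≫ r ≫ p)
    (by simpa using Conflation.zero ⟨B, i, _, h⟩)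
  exact ⟨K, ⟨B, i, _, h⟩, r, k, hB, hr, rfl, hk.symm⟩

/-- A short exact sequence, pulled back along a morphism `x` from an object of `F`, is dominated by
a short exact sequence in `F` that can be compared with all others after refinement. -/
theorem Conflation.exists_resolution (hgen : E.Generating F) (hker : E.KernelClosed F)
    {A X X₁ : 𝒞} (S : E.Conflation A X) (hX₁ : F X₁) (x : X₁ ⟶ X) :
    ∃ (K : 𝒞) (T : E.Conflation K X₁) (k : K ⟶ A) (b : T.B ⟶ S.B), F K ∧ F T.B ∧
      T.i ≫ b = k ≫ S.i ∧ T.p ≫ x = b ≫ S.p ∧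
      ∀ {Y Z X₂ : 𝒞} (_ : F Y) (y : Y ⟶ X₁) (V : E.Conflation Z X₂) (y' : Y ⟶ X₂) (z : Z ⟶ A)
        (c : V.B ⟶ S.B) (x' : X₂ ⟶ X), V.i ≫ c = z ≫ S.i → V.p ≫ x' = c ≫ S.p →
        y ≫ x = y' ≫ x' →
        ∃ (L : 𝒞) (W : E.Conflation L Y) (l : L ⟶ K) (l' : L ⟶ Z) (d : W.B ⟶ T.B)
          (d' : W.B ⟶ V.B), F L ∧ F W.B ∧ W.i ≫ d = l ≫ T.i ∧ W.p ≫ y = d ≫ T.p ∧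
          W.i ≫ d' = l' ≫ V.i ∧ W.p ≫ y' = d' ≫ V.p ∧ l ≫ k = l' ≫ z := by
  obtain ⟨g, hg, hgi⟩ := S.pull_spec x
  -- The cover is taken onto the whole middle term of the pulled back sequence, not merely onto
  -- `X₁`. That `r` is an admissible epic is what allows refinements to be lifted below.
  obtain ⟨K, T, r, k, hB, hr, hTp, hTi⟩ := exists_of_generating (F := F) hgen (S.pull x) (𝟙 _)
    (by simpa using ⟨_, _, (S.pull x).ses⟩)
  simp only [Category.id_comp, Category.comp_id] at hTp hTi
  refine ⟨K, T, k, r ≫ g, hker _ _ T.ses hB hX₁, hB, by rw [reassoc_of% hTi, hgi],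
    by rw [hTp, Category.assoc, Category.assoc, hg.w], ?_⟩
  intro Y Z X₂ hY y V y' z c x' hi hp hy
  obtain ⟨g', hg', hgi'⟩ := V.pull_spec y'
  let h : (V.pull y').B ⟶ (S.pull x).B := hg.lift (g' ≫ c) ((V.pull y').p ≫ y)
    (by simp [hy, ← hp, reassoc_of% hg'.w])
  have hh : h ≫ g = g' ≫ c := hg.lift_fst _ _ _
  have hh' : h ≫ (S.pull x).p = (V.pull y').p ≫ y := hg.lift_snd _ _ _
  obtain ⟨_, ir, hr⟩ := hr
  -- `R` maps to the middle terms of both `T` and the pullback of `V`, and is still an admissible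
  -- epic cover of the latter, hence of `Y`. A cover of `R` from `F` is the common refinement.
  obtain ⟨R, e, ir', r', sq, -, hR⟩ := E.pullback h hr
  obtain ⟨L, W, s, l', hWB, hs, hWp, hWi⟩ := exists_of_generating (F := F) hgen (V.pull y') r'
    (E.comp_epic ⟨_, _, hR⟩ ⟨_, _, (V.pull y').ses⟩)
  obtain ⟨w, ⟨hk⟩, -⟩ := E.kernel_cokernel T.ses
  have hd : W.p ≫ y = (s ≫ e) ≫ T.p := by
    rw [hTp, hWp]
    simp only [Category.assoc, ← hh', reassoc_of% sq.w]
  obtain ⟨l, hl⟩ := KernelFork.IsLimit.lift' hk (W.i ≫ s ≫ e)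
    (by rw [Category.assoc, ← hd, reassoc_of% W.zero, zero_comp])
  change l ≫ T.i = _ at hl
  have hd' : W.i ≫ s ≫ r' ≫ g' = l' ≫ V.i := by rw [reassoc_of% hWi, hgi']
  have := S.mono
  refine ⟨L, W, l, l', s ≫ e, s ≫ r' ≫ g', hker _ _ W.ses hWB hY, hWB, hl.symm, hd, hd', ?_, ?_⟩
  · simp [hWp, hg'.w]
  · rw [← cancel_mono S.i, Category.assoc, Category.assoc, ← hi, ← reassoc_of% hd', ← hh,
      ← hgi, ← reassoc_of% hTi, reassoc_of% hl, reassoc_of% sq.w]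

/-- An exact sequence, pulled back along a morphism `x` from an object of `F`, is dominated by an
exact sequence in `F` that can be compared with all others after refinement. -/
theorem ExactSeq.exists_resolution (hgen : E.Generating F) (hker : E.KernelClosed F)
    {A X X₁ : 𝒞} {n : ℕ} (U : E.ExactSeq A X n) (hX₁ : F X₁) (x : X₁ ⟶ X) :
    ∃ (K : 𝒞) (T : E.ExactSeq K X₁ n) (a : K ⟶ A), T.TermsIn F ∧ IsMap a T U x ∧
      ∀ {Y K' X₂ : 𝒞} (_ : F Y) (y : Y ⟶ X₁) (V : E.ExactSeq K' X₂ n) (y' : Y ⟶ X₂) (b : K' ⟶ A)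
        (x' : X₂ ⟶ X), IsMap b V U x' → y ≫ x = y' ≫ x' →
        ∃ (L : 𝒞) (W : E.ExactSeq L Y n) (w : L ⟶ K) (v : L ⟶ K'), W.TermsIn F ∧ IsMap w W T y ∧
          IsMap v W V y' ∧ w ≫ a = v ≫ b := by
  induction U generalizing X₁ with
  | single S =>
    obtain ⟨K, T, k, b, hK, hB, hi, hp, H⟩ := S.exists_resolution hgen hker hX₁ x
    refine ⟨K, .single T, k, ⟨hK, hB, hX₁⟩, .single _ _ b _ hi hp, ?_⟩
    intro Y K' X₂ hY y V y' z x' hV hy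
    cases hV with
    | single V _ c _ hi' hp' =>
      obtain ⟨L, W, l, l', d, d', hL, hWB, h₁, h₂, h₃, h₄, h₅⟩ := H hY y V y' z c x' hi' hp' hy
      exact ⟨L, .single W, l, l', ⟨hL, hWB, hY⟩, .single _ _ d _ h₁ h₂, .single _ _ d' _ h₃ h₄, h₅⟩
  | splice U S ih =>
    obtain ⟨K, T, k, b, hK, hB, hi, hp, H⟩ := S.exists_resolution hgen hker hX₁ x
    obtain ⟨K₀, T₀, a, hT₀, hm, H₀⟩ := ih hK k
    refine ⟨K₀, .splice T₀ T, a, ⟨hT₀, hB, hX₁⟩, .splice _ _ _ _ k b _ hm hi hp, ?_⟩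
    intro Y K' X₂ hY y V y' z x' hV hy
    cases hV with
    | splice V₀ _ V _ z₀ c _ hV₀ hi' hp' =>
      obtain ⟨L, W, l, l', d, d', hL, hWB, h₁, h₂, h₃, h₄, h₅⟩ := H hY y V y' z₀ c x' hi' hp' hy
      -- The agreement `h₅` on the syzygy is exactly the compatibility that the next splice
      -- requires; this is why the comparison is formulated for arbitrary `y` and `y'` rather than
      -- for identities.
      obtain ⟨L₀, W₀, w, v, hW₀, h₆, h₇, h₈⟩ := H₀ hL l V₀ l' z z₀ hV₀ h₅
      exact ⟨L₀, .splice W₀ W, w, v, ⟨hW₀, hWB, hY⟩, .splice _ _ _ _ l d _ h₆ h₁ h₂,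
        .splice _ _ _ _ l' d' _ h₇ h₃ h₄, h₈⟩

end Resolution

/-! ### Transport of ladders across the adjunction; bijectivity of Θ. -/

section Functor

variable {𝒞 : Type u₁} [Category.{v₁} 𝒞] [Preadditive 𝒞]
  {𝒟 : Type u₂} [Category.{v₂} 𝒟] [Preadditive 𝒟]
  {E : ExactStructure 𝒞} {E' : ExactStructure 𝒟}

theorem ExactOn.isPreserved {R : 𝒞 ⥤ 𝒟} {F : ObjectProperty 𝒞} (hR : ExactOn E E' R F) {A X : 𝒞}
    {n : ℕ} {T : E.ExactSeq A X n} (hT : T.TermsIn F) : T.IsPreserved E' R := by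
  induction T with
  | single S => exact hR _ _ hT.1 hT.2.1 hT.2.2 S.ses
  | splice T S ih => exact ⟨ih hT.1, hR _ _ hT.1.right hT.2.1 hT.2.2 S.ses⟩

theorem ExactSeq.isPreserved_of_forall {R : 𝒞 ⥤ 𝒟}
    (hR : ∀ ⦃A B X : 𝒞⦄ (i : A ⟶ B) (p : B ⟶ X), E.Ses i p → E'.Ses (R.map i) (R.map p)) {A X : 𝒞}
    {n : ℕ} (T : E.ExactSeq A X n) : T.IsPreserved E' R := by
  induction T with
  | single S => exact hR _ _ S.ses
  | splice T S ih => exact ⟨ih, hR _ _ S.ses⟩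

variable {q : 𝒞 ⥤ 𝒟} {t : 𝒟 ⥤ 𝒞} (adj : q ⊣ t)

/-- A morphism `T ⟶ t(U)` of exact sequences is adjoint to a morphism `q(T) ⟶ U`. -/
theorem ExactSeq.IsMap.homEquiv_symm {K X : 𝒞} {A Y : 𝒟} {n : ℕ} {T : E.ExactSeq K X n}
    {U : E'.ExactSeq A Y n} (hT : T.IsPreserved E' q) (hU : U.IsPreserved E t) {a : K ⟶ t.obj A}
    {x : X ⟶ t.obj Y} (h : IsMap a T (U.map E t hU) x) :
    IsMap ((adj.homEquiv _ _).symm a) (T.map E' q hT) U ((adj.homEquiv _ _).symm x) := by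
  induction T generalizing Y with
  | single S =>
    cases U with
    | single S' =>
      cases h with
      | single _ _ b _ hi hp =>
        exact .single _ _ ((adj.homEquiv _ _).symm b) _
          (by simp only [← adj.homEquiv_naturality_left_symm, hi, adj.homEquiv_naturality_right_symm])
          (by simp only [← adj.homEquiv_naturality_left_symm, hp, adj.homEquiv_naturality_right_symm])
    | splice T => nomatch T
  | splice T S ih =>
    cases U with
    | single S => nomatch T
    | splice U S' =>
      cases h with
      | splice _ _ _ _ z b _ hz hi hp =>
        exact .splice _ _ _ _ ((adj.homEquiv _ _).symm z) ((adj.homEquiv _ _).symm b) _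
          (ih hT.1 hU.1 hz)
          (by simp only [← adj.homEquiv_naturality_left_symm, hi, adj.homEquiv_naturality_right_symm])
          (by simp only [← adj.homEquiv_naturality_left_symm, hp, adj.homEquiv_naturality_right_symm])

/-- The unit is a morphism of exact sequences `T ⟶ t(q(T))`. -/
theorem ExactSeq.unit_isMap {K X : 𝒞} {n : ℕ} (T : E.ExactSeq K X n) (hT : T.IsPreserved E' q)
    (hT' : (T.map E' q hT).IsPreserved E t) :
    IsMap (adj.unit.app K) T ((T.map E' q hT).map E t hT') (adj.unit.app X) := by
  induction T with
  | single S =>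
    refine .single _ _ (adj.unit.app S.B) _ ?_ ?_
    · exact adj.unit.naturality S.i
    · exact adj.unit.naturality S.p
  | splice T S ih =>
    refine .splice _ _ _ _ (adj.unit.app _) (adj.unit.app S.B) _ (ih hT.1 hT'.1) ?_ ?_
    · exact adj.unit.naturality S.i
    · exact adj.unit.naturality S.p

theorem thetaFun_mk {n : ℕ} {X : 𝒞} (h : PreservesExtFrom E' E t n (q.obj X)) {A : 𝒟}
    (T : E'.ExactSeq A (q.obj X) n) :
    thetaFun adj h A (.mk T) = .pull (adj.unit.app X) (.mk (T.map E t (h A T))) := rfl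

/-- The inverse replaces a sequence by a resolution in `F`, on which `q` is exact, and pushes its
image out along the adjunct of the left component. -/
theorem thetaFun_bijective {F : ObjectProperty 𝒞} (hgen : E.Generating F)
    (hker : E.KernelClosed F) (hq : ExactOn E E' q F) {n : ℕ} {X : 𝒞} (hX : F X)
    (h : PreservesExtFrom E' E t n (q.obj X)) (A : 𝒟) :
    Function.Bijective (thetaFun adj h A) := by
  choose K T a hT hm H using fun U : E.ExactSeq (t.obj A) X n =>
    U.exists_resolution hgen hker hX (𝟙 X)
  have hT' := fun U => hq.isPreserved (hT U)
  let Ψ : E.Ext n X (t.obj A) → E'.Ext n (q.obj X) A :=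
    Quot.lift (fun U => .push ((adj.homEquiv _ _).symm (a U)) (.mk ((T U).map E' q (hT' U)))) <| by
      intro U U' hU
      -- Related sequences `U` and `U'` have resolutions that both lie over `U'`, one through `U`.
      -- Their common refinement `W` lies in `F`, so `q(W)` compares the two images.
      obtain ⟨L, W, w, v, hW, hw, hv, e⟩ := H U' hX (𝟙 X) (T U) (𝟙 X) (a U ≫ 𝟙 _) (𝟙 X ≫ 𝟙 X)
        ((hm U).comp hU) (by simp)
      have hW' := hq.isPreserved hW
      have hw' := Ext.push_eq_pull (hw.map hW' (hT' U'))
      have hv' := Ext.push_eq_pull (hv.map hW' (hT' U))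
      simp only [q.map_id, Ext.pull_id] at hw' hv'
      rw [Category.comp_id] at e
      simp only [← hw', ← hv', Ext.push_push, ← adj.homEquiv_naturality_left_symm, e]
  refine Function.bijective_iff_has_inverse.2 ⟨Ψ, fun e => ?_, fun e => ?_⟩
  · induction e using Quot.ind with
    | mk U =>
      -- The ladder from the resolution of `V` through `V` to `t(U)` has the unit as right
      -- component. Its adjunct therefore ends in the identity of `q(X)`, which exhibits the pushout
      -- as `[U]`.
      let V := (U.map E t (h A U)).pull (adj.unit.app X)
      have := Ext.push_eq_pull (IsMap.homEquiv_symm adj (hT' V) (h A U)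
        ((hm V).comp (pull_isMap _ _)))
      simp only [Category.comp_id, Category.id_comp] at this
      refine this.trans ?_
      rw [← adj.homEquiv_id, Equiv.symm_apply_apply, Ext.pull_id]
      rfl
  · induction e using Quot.ind with
    | mk U =>
      -- By naturality and the unit ladder from `T U` to its image under `q` followed by `t`, the
      -- class becomes the pushout of `[T U]` along the unit followed by `t` of the adjunct of `a
      -- U`, that is, along `a U` itself.
      refine (thetaFun_push adj h _ _).trans ?_
      rw [thetaFun_mk, ← Ext.push_eq_pull ((T U).unit_isMap adj (hT' U) (h _ _)), Ext.push_push]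
      refine (congrArg (fun f => Ext.push f (.mk (T U))) ((adj.homEquiv_unit ..).symm.trans
        (Equiv.apply_symm_apply _ (a U)))).trans ?_
      rw [Ext.push_eq_pull (hm U), Ext.pull_id]
      rfl

end Functor

/-! ### Exactness of the right adjoint, and exactness of `q` on the class from Θ¹. -/

section Exactness

variable {𝒞 : Type u₁} [Category.{v₁} 𝒞] [Preadditive 𝒞] [HasZeroObject 𝒞]
  [HasBinaryBiproducts 𝒞]
  {𝒟 : Type u₂} [Category.{v₂} 𝒟] [Preadditive 𝒟] [HasZeroObject 𝒟] [HasBinaryBiproducts 𝒟]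
  {E : ExactStructure 𝒞} {E' : ExactStructure 𝒟} {q : 𝒞 ⥤ 𝒟} {t : 𝒟 ⥤ 𝒞} (adj : q ⊣ t)
  {F : ObjectProperty 𝒞}

-- Exactness can be tested after covering `t(X)` by an object `Y` of `F`, where the sequence pulled
-- back to `q(Y)` falls under the hypothesis; the obscure axiom then descends from the cover.
include adj in
theorem ses_map_of_preservesExtFrom (hgen : E.Generating F)
    (h : ∀ X : 𝒞, F X → PreservesExtFrom E' E t 1 (q.obj X)) ⦃A B X : 𝒟⦄ (i : A ⟶ B) (p : B ⟶ X)
    (hs : E'.Ses i p) : E.Ses (t.map i) (t.map p) := by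
  have := adj.isRightAdjoint
  have : PreservesLimitsOfSize.{0, 0} t := adj.rightAdjoint_preservesLimits
  have : t.Additive := Functor.additive_of_preserves_binary_products t
  obtain ⟨w, ⟨hk⟩, -⟩ := E'.kernel_cokernel hs
  obtain ⟨Y, y, hY, hy⟩ := hgen (t.obj X)
  obtain ⟨P, g, i', p', sq, -, hP⟩ := E'.pullback ((adj.homEquiv _ _).symm y) hs
  have hP' : E.Ses (t.map i') (t.map p') := h Y hY A (.single ⟨P, i', p', hP⟩)
  obtain ⟨R, f, j, r, sq', -, hR⟩ := E.pullback (adj.unit.app Y) hP'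
  refine ses_of_isLimit (isLimitForkMapOfIsLimit' t w hk) (f ≫ t.map g) ?_
  have e : (f ≫ t.map g) ≫ t.map p = r ≫ y := by
    rw [Category.assoc, ← t.map_comp, sq.w, t.map_comp, reassoc_of% sq'.w, ← adj.homEquiv_unit,
      Equiv.apply_symm_apply]
  rw [e]
  exact E.comp_epic ⟨_, _, hR⟩ hy

/-- A preimage under Θ¹ of the pushout along the unit of `K` provides an admissible monic out of
`q(K)` that factors through `q(i)`. -/
theorem exactOn_of_thetaFun_surjective
    (h : ∀ X : 𝒞, F X → PreservesExtFrom E' E t (0 + 1) (q.obj X))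
    (hs : ∀ (X : 𝒞) (hX : F X) (A : 𝒟), Function.Surjective (thetaFun adj (h X hX) A)) :
    ExactOn E E' q F := by
  intro K B X i p _ _ hX hi
  have := adj.isLeftAdjoint
  have : PreservesColimitsOfSize.{0, 0} q := adj.leftAdjoint_preservesColimits
  have := preservesBinaryBiproducts_of_preservesBinaryCoproducts q
  have : q.Additive := Functor.additive_of_preservesBinaryBiproducts q
  obtain ⟨w, -, ⟨hc⟩⟩ := E.kernel_cokernel hi
  let S : E.Conflation K X := ⟨B, i, p, hi⟩
  obtain ⟨e, he⟩ := hs X hX (q.obj K) (.mk (.single (S.push (adj.unit.app K))))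
  induction e using Quot.ind with
  | mk U =>
    -- This ladder runs from the given sequence to `t(U)` and has the units of `K` and `X` as end
    -- components. The adjunct of its middle component extends `S'.i` along `q.map i`, since the
    -- adjunct of the unit is the identity.
    have hm := (push_isMap (adj.unit.app K) (.single S)).comp ((Ext.exists_isMap he.symm).comp
      (pull_isMap _ _))
    simp only [Category.comp_id, Category.id_comp] at hm
    cases U with
    | single S' =>
      cases hm with
      | single _ _ b _ h₁ h₂ =>
        refine ses_of_isColimit (isColimitCoforkMapOfIsColimit' q w hc)
          ((adj.homEquiv _ _).symm b) ?_
        have e : q.map i ≫ (adj.homEquiv _ _).symm b = S'.i := by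
          rw [← adj.homEquiv_naturality_left_symm]
          change (adj.homEquiv _ _).symm (S.i ≫ b) = _
          rw [h₁]
          rw [Equiv.symm_apply_eq]
          exact (congrArg (· ≫ t.map S'.i) (Category.comp_id (adj.unit.app K))).trans
            (adj.homEquiv_unit ..).symm
        rw [e]
        exact ⟨_, _, S'.ses⟩
    | splice T => nomatch T

/-- The converse uses only surjectivity in degree one, which is the case `n = 0` of the index here.
-/
theorem theta_comparison (hgen : E.Generating F) (hker : E.KernelClosed F)
    (h : ∀ X : 𝒞, F X → PreservesExtFrom E' E t 1 (q.obj X)) :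
    ∃ h : ∀ (X : 𝒞), F X → ∀ n : ℕ, PreservesExtFrom E' E t (n + 1) (q.obj X),
      (ExactOn E E' q F ↔ ∀ (X : 𝒞) (hX : F X) (n : ℕ) (A : 𝒟),
        Function.Bijective (thetaFun adj (h X hX n) A)) :=
  ⟨fun _ _ _ _ T => T.isPreserved_of_forall (ses_map_of_preservesExtFrom adj hgen h),
    fun hq _ hX _ A => thetaFun_bijective adj hgen hker hq hX _ A,
    fun H => exactOn_of_thetaFun_surjective adj _ fun X hX A => (H X hX 0 A).2⟩

end Exactness

/-! ### Yoneda extensions in the opposite category. -/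

section Opposite

variable {𝒞 : Type u} [Category.{v} 𝒞] [Preadditive 𝒞] {E : ExactStructure 𝒞}

/-- The opposite of a short exact sequence. -/
def Conflation.op {A X : 𝒞} (S : E.Conflation A X) : E.op.Conflation (.op X) (.op A) :=
  ⟨.op S.B, S.p.op, S.i.op, S.ses⟩

/-- The short exact sequence with the given opposite. -/
def Conflation.unop {A X : 𝒞ᵒᵖ} (S : E.op.Conflation A X) : E.Conflation X.unop A.unop :=
  ⟨S.B.unop, S.p.unop, S.i.unop, S.ses⟩

namespace ExactSeq

/-- Splicing a short exact sequence on the left. -/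
def cons {A Z : 𝒞} (S : E.Conflation A Z) :
    ∀ {X : 𝒞} {n : ℕ}, E.ExactSeq Z X n → E.ExactSeq A X (n + 1)
  | _, _, .single S' => .splice (.single S) S'
  | _, _, .splice T S' => .splice (cons S T) S'

/-- The opposite of an exact sequence. -/
def op {A : 𝒞} : ∀ {X : 𝒞} {n : ℕ}, E.ExactSeq A X n → E.op.ExactSeq (.op X) (.op A) n
  | _, _, .single S => .single S.op
  | _, _, .splice T S => .cons S.op T.op

/-- The exact sequence with the given opposite. -/
def unop {A : 𝒞ᵒᵖ} : ∀ {X : 𝒞ᵒᵖ} {n : ℕ}, E.op.ExactSeq A X n → E.ExactSeq X.unop A.unop n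
  | _, _, .single S => .single S.unop
  | _, _, .splice T S => .cons S.unop T.unop

/-- Reversing a sequence exchanges splicing on the left with splicing on the right; this is what
makes reversal an involution. -/
theorem op_cons {A Z X : 𝒞} {n : ℕ} (S : E.Conflation A Z) (T : E.ExactSeq Z X n) :
    (cons S T).op = .splice T.op S.op := by
  induction T with
  | single S' => rfl
  | splice T S' ih => exact congrArg (cons S'.op) ih

theorem unop_cons {A Z X : 𝒞ᵒᵖ} {n : ℕ} (S : E.op.Conflation A Z) (T : E.op.ExactSeq Z X n) :
    (cons S T).unop = .splice T.unop S.unop := by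
  induction T with
  | single S' => rfl
  | splice T S' ih => exact congrArg (cons S'.unop) ih

theorem unop_op {A X : 𝒞} {n : ℕ} (T : E.ExactSeq A X n) : T.op.unop = T := by
  induction T with
  | single S => rfl
  | splice T S ih => exact (unop_cons S.op T.op).trans (congrArg (splice · S) ih)

theorem op_unop {A X : 𝒞ᵒᵖ} {n : ℕ} (T : E.op.ExactSeq A X n) : T.unop.op = T := by
  induction T with
  | single S => rfl
  | splice T S ih => exact (op_cons S.unop T.unop).trans (congrArg (splice · S) ih)

theorem IsMap.cons {A A' Z Z' X X' : 𝒞} {n : ℕ} {S : E.Conflation A Z} {S' : E.Conflation A' Z'}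
    {T : E.ExactSeq Z X n} {T' : E.ExactSeq Z' X' n} {a : A ⟶ A'} {z : Z ⟶ Z'} {x : X ⟶ X'}
    (b : S.B ⟶ S'.B) (hi : S.i ≫ b = a ≫ S'.i) (hp : S.p ≫ z = b ≫ S'.p) (h : IsMap z T T' x) :
    IsMap a (cons S T) (cons S' T') x := by
  induction h with
  | single S₁ S₁' b₁ x hi₁ hp₁ => exact .splice _ _ _ _ z b₁ x (.single _ _ b z hi hp) hi₁ hp₁
  | splice T T' S₁ S₁' z₁ b₁ x _ hi₁ hp₁ ih => exact .splice _ _ _ _ z₁ b₁ x ih hi₁ hp₁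

theorem IsMap.op {A A' X X' : 𝒞} {n : ℕ} {T : E.ExactSeq A X n} {T' : E.ExactSeq A' X' n}
    {a : A ⟶ A'} {x : X ⟶ X'} (h : IsMap a T T' x) : IsMap x.op T'.op T.op a.op := by
  induction h with
  | single S S' b x hi hp =>
    exact .single S'.op S.op b.op _ (congrArg Quiver.Hom.op hp).symm (congrArg Quiver.Hom.op hi).symm
  | splice T T' S S' z b x _ hi hp ih =>
    exact .cons (S := S'.op) (S' := S.op) b.op (congrArg Quiver.Hom.op hp).symm
      (congrArg Quiver.Hom.op hi).symm ih

theorem IsMap.unop {A A' X X' : 𝒞ᵒᵖ} {n : ℕ} {T : E.op.ExactSeq A X n}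
    {T' : E.op.ExactSeq A' X' n} {a : A ⟶ A'} {x : X ⟶ X'} (h : IsMap a T T' x) :
    IsMap x.unop T'.unop T.unop a.unop := by
  induction h with
  | single S S' b x hi hp =>
    exact .single S'.unop S.unop b.unop _ (congrArg Quiver.Hom.unop hp).symm
      (congrArg Quiver.Hom.unop hi).symm
  | splice T T' S S' z b x _ hi hp ih =>
    exact .cons (S := S'.unop) (S' := S.unop) b.unop (congrArg Quiver.Hom.unop hp).symm
      (congrArg Quiver.Hom.unop hi).symm ih

end ExactSeq

/-- The identification of the extensions in a category with those in its opposite. -/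
def Ext.opEquiv {n : ℕ} {X A : 𝒞} : E.Ext n X A ≃ E.op.Ext n (.op A) (.op X) where
  toFun := Quot.lift (fun T => .mk T.op) fun _ _ h => (Ext.sound h.op).symm
  invFun := Quot.lift (fun T => .mk T.unop) fun _ _ h => (Ext.sound h.unop).symm
  left_inv e := by
    induction e using Quot.ind with
    | mk T => exact congrArg Ext.mk T.unop_op
  right_inv e := by
    induction e using Quot.ind with
    | mk T => exact congrArg Ext.mk T.op_unop

end Opposite

/-! ### Duality between Θ and Ω. -/

section Functor

variable {𝒞 : Type u₁} [Category.{v₁} 𝒞] [Preadditive 𝒞]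
  {𝒟 : Type u₂} [Category.{v₂} 𝒟] [Preadditive 𝒟]
  {E : ExactStructure 𝒞} {E' : ExactStructure 𝒟} {R : 𝒞 ⥤ 𝒟}

namespace ExactSeq

theorem isPreserved_cons {A Z X : 𝒞} {n : ℕ} (S : E.Conflation A Z) (T : E.ExactSeq Z X n) :
    (cons S T).IsPreserved E' R ↔ E'.Ses (R.map S.i) (R.map S.p) ∧ T.IsPreserved E' R := by
  induction T with
  | single S' => rfl
  | splice T S' ih => exact (and_congr_left' ih).trans and_assoc

theorem isPreserved_op {A X : 𝒞} {n : ℕ} (T : E.ExactSeq A X n) :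
    T.op.IsPreserved E'.op R.op ↔ T.IsPreserved E' R := by
  induction T with
  | single S => rfl
  | splice T S ih => exact (isPreserved_cons S.op T.op).trans ((and_congr_right' ih).trans and_comm)

theorem map_cons {A Z X : 𝒞} {n : ℕ} (S : E.Conflation A Z) (T : E.ExactSeq Z X n)
    (hS : E'.Ses (R.map S.i) (R.map S.p)) (hT : T.IsPreserved E' R)
    (h : (cons S T).IsPreserved E' R) :
    (cons S T).map E' R h = cons ⟨R.obj S.B, R.map S.i, R.map S.p, hS⟩ (T.map E' R hT) := by
  induction T with
  | single S' => rfl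
  | splice T S' ih => exact congrArg (splice · _) (ih hT.1 h.1)

theorem map_op {A X : 𝒞} {n : ℕ} (T : E.ExactSeq A X n) (h : T.IsPreserved E' R)
    (h' : T.op.IsPreserved E'.op R.op) : T.op.map E'.op R.op h' = (T.map E' R h).op := by
  induction T with
  | single S => rfl
  | splice T S ih =>
    exact (map_cons S.op T.op h.2 ((isPreserved_op T).2 h.1) h').trans
      (congrArg (cons _) (ih h.1 _))

end ExactSeq

theorem preservesExtFrom_op {n : ℕ} {A : 𝒞} :
    PreservesExtFrom E.op E'.op R.op n (.op A) ↔ PreservesExtTo E E' R n A :=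
  ⟨fun h X T => (isPreserved_op T).1 (h (.op X) T.op),
    fun h X T => by rw [← op_unop T]; exact (isPreserved_op T.unop).2 (h X.unop T.unop)⟩

theorem exactOn_op {F : ObjectProperty 𝒞} : ExactOn E.op E'.op R.op F.op ↔ ExactOn E E' R F :=
  ⟨fun h A B X i p hA hB hX hs => h (A := .op X) (B := .op B) (X := .op A) p.op i.op hX hB hA hs,
    fun h _ _ _ i p hA hB hX hs => h p.unop i.unop hX hB hA hs⟩

variable {q : 𝒞 ⥤ 𝒟} {t : 𝒟 ⥤ 𝒞} (adj : q ⊣ t)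

/-- The unit of the opposite adjunction is the opposite of the counit, and reversal turns a pushout
ladder into a pullback ladder. -/
theorem thetaFun_op {n : ℕ} {A : 𝒟} (h : PreservesExtTo E E' q n (t.obj A))
    (h' : PreservesExtFrom E.op E'.op q.op n (t.op.obj (.op A))) (X : 𝒞)
    (e : E.Ext n X (t.obj A)) :
    thetaFun adj.op h' (.op X) (Ext.opEquiv e) = Ext.opEquiv (omegaFun adj h X e) := by
  induction e using Quot.ind with
  | mk T =>
    refine (Ext.sound (IsMap.pull_lift ?_)).symm
    have := (push_isMap (adj.counit.app A) (T.map E' q (h X T))).op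
    rw [← map_op T (h X T) (h' _ T.op)] at this
    exact this.congr rfl (Category.id_comp _).symm

theorem thetaFun_op_bijective {n : ℕ} {A : 𝒟} (h : PreservesExtTo E E' q n (t.obj A))
    (h' : PreservesExtFrom E.op E'.op q.op n (t.op.obj (.op A))) (X : 𝒞) :
    Function.Bijective (thetaFun adj.op h' (.op X)) ↔ Function.Bijective (omegaFun adj h X) :=
  (Function.Bijective.of_comp_iff _ Ext.opEquiv.bijective).symm.trans <|
    (iff_of_eq (congrArg Function.Bijective (funext (thetaFun_op adj h h' X)))).trans <|
      Function.Bijective.of_comp_iff' Ext.opEquiv.bijective _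

variable [HasZeroObject 𝒞] [HasBinaryBiproducts 𝒞] [HasZeroObject 𝒟] [HasBinaryBiproducts 𝒟]

theorem omega_comparison {G : ObjectProperty 𝒟} (hcogen : E'.Cogenerating G)
    (hcoker : E'.CokernelClosed G) (h : ∀ A : 𝒟, G A → PreservesExtTo E E' q 1 (t.obj A)) :
    ∃ h : ∀ (A : 𝒟), G A → ∀ n : ℕ, PreservesExtTo E E' q (n + 1) (t.obj A),
      (ExactOn E' E t G ↔ ∀ (A : 𝒟) (hA : G A) (n : ℕ) (X : 𝒞),
        Function.Bijective (omegaFun adj (h A hA n) X)) := by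
  have hgen : E'.op.Generating G.op := fun X => by
    obtain ⟨B, i, hB, hi⟩ := hcogen X.unop
    exact ⟨.op B, i.op, hB, (op_admissibleEpic E').2 hi⟩
  have hker : E'.op.KernelClosed G.op := fun _ _ _ i p hs hB hX => hcoker p.unop i.unop hs hX hB
  obtain ⟨h', H⟩ := theta_comparison adj.op hgen hker
    fun A hA => preservesExtFrom_op.2 (h A.unop hA)
  refine ⟨fun A hA n => preservesExtFrom_op.1 (h' (.op A) hA n), ?_⟩
  rw [← exactOn_op, H]
  exact ⟨fun H A hA n X => (thetaFun_op_bijective adj _ _ X).1 (H (.op A) hA n (.op X)),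
    fun H A hA n X => (thetaFun_op_bijective adj _ _ X.unop).2 (H A.unop hA n X.unop)⟩

end Functor

end ExactStructure

theorem lemma2p12
    {𝒞 : Type u₁} [Category.{v₁} 𝒞] [Preadditive 𝒞] [HasZeroObject 𝒞] [HasBinaryBiproducts 𝒞]
    {𝒟 : Type u₂} [Category.{v₂} 𝒟] [Preadditive 𝒟] [HasZeroObject 𝒟] [HasBinaryBiproducts 𝒟]
    (E : ExactStructure 𝒞) (E' : ExactStructure 𝒟)
    (hC : WeaklyIdempotentComplete 𝒞) (hD : WeaklyIdempotentComplete 𝒟)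
    (q : 𝒞 ⥤ 𝒟) (t : 𝒟 ⥤ 𝒞) (adj : q ⊣ t)
    (F : ObjectProperty 𝒞) (G : ObjectProperty 𝒟)
    (hF_ext : E.ExtensionClosed F) (hF_gen : E.Generating F) (hF_ker : E.KernelClosed F)
    (hG_ext : E'.ExtensionClosed G) (hG_cogen : E'.Cogenerating G)
    (hG_coker : E'.CokernelClosed G) :
    ((∀ X : 𝒞, F X → ExactStructure.PreservesExtFrom E' E t 1 (q.obj X)) →
      ∃ h : ∀ (X : 𝒞), F X → ∀ n : ℕ, ExactStructure.PreservesExtFrom E' E t (n + 1) (q.obj X),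
        (ExactStructure.ExactOn E E' q F ↔
          ∀ (X : 𝒞) (hX : F X) (n : ℕ) (A : 𝒟),
            Function.Bijective (ExactStructure.Theta adj (h X hX n) A))) ∧
    ((∀ A : 𝒟, G A → ExactStructure.PreservesExtTo E E' q 1 (t.obj A)) →
      ∃ h : ∀ (A : 𝒟), G A → ∀ n : ℕ, ExactStructure.PreservesExtTo E E' q (n + 1) (t.obj A),
        (ExactStructure.ExactOn E' E t G ↔
          ∀ (A : 𝒟) (hA : G A) (n : ℕ) (X : 𝒞),
            Function.Bijective (ExactStructure.Omega adj (h A hA n) X))) := by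
  -- The underlying maps of `Theta` and `Omega` are `thetaFun` and `omegaFun` by definition, so the
  -- statements about maps of sets apply directly.
  exact ⟨ExactStructure.theta_comparison adj hF_gen hF_ker,
    ExactStructure.omega_comparison adj hG_cogen hG_coker⟩
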